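/- Let $n,k,\ell\ge 0$, $r\ge 1$, $p\ge 1$ be integers and work in Euclidean $\mathbb R^n$. Write $\mathrm{Alt}^k(V)$ for the alternating $k$-forms on $V$, $\mathrm{Alt}^{k,\ell}(V)=\mathrm{Alt}^k(V)\otimes\mathrm{Alt}^\ell(V)$, and, for a simplex $\sigma$, let $\mathrm{Alt}^k(\sigma)$ and $\mathrm{Alt}^k(\sigma^\perp)$ denote the alternating forms on the tangent space of $\sigma$ and on its orthogonal complement (zero for negative degree). Let $\mathcal P_r\mathrm{Alt}^{k}(\sigma)$ and $\mathcal P_r\mathrm{Alt}^{k,\ell}(\sigma)$ be the forms on $\sigma$ with polynomial coefficients of degree at most $r$. *Traces.* $\iota_\sigma^*$ is the pullback to $\sigma$. For an $\ell$-form $\omega$ on $\mathbb R^n$, $\vartheta_{\sigma,q}^*\omega\in \mathrm{Alt}^q(\sigma)\otimes\mathrm{Alt}^{\ell-q}(\sigma^\perp)$ (pointwise on $\sigma$) is its component with $q$ arguments tangential and $\ell-q$ arguments normal to $\sigma$ (zero unless $0\le q\le \ell$). Put $\jmath_\sigma^*=\vartheta_{\sigma,\dim\sigma}^*$ and $\jmath_{\sigma,[p]}^*=\sum_{s=0}^{p-1}\vartheta^*_{\sigma,\dim\sigma-s}$,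 a direct sum. For $(k,\ell)$-forms, $\iota^*\iota^*$, $\iota^*\jmath^*$, $\iota^*\jmath^*_{[p]}$ apply the first operator to the $k$-form index and the second to the $\ell$-form index. *Bubbles.* $\mathcal B_r\mathrm{Alt}^k(\sigma)$ is the set of $b\in\mathcal P_r\mathrm{Alt}^k(\sigma)$ with $\iota_F^*b=0$ for all proper subsimplices $F$ of $\sigma$, and $\mathcal B_r\mathrm{Alt}^{k,\ell}(\sigma)$ the set of $b\in\mathcal P_r\mathrm{Alt}^{k,\ell}(\sigma)$ with $\iota_F^*\iota_F^*b=0$ for all proper subsimplices $F$ of $\sigma$. Let $\langle\cdot,\cdot\rangle_\sigma$ be the Euclidean inner product of the values, integrated over $\sigma$ with respect to the $\dim\sigma$-dimensional measure. **Theorem.** Let $K$ be a nondegenerate $n$-simplex in $\mathbb R^n$. Each of the following three groups of degrees of freedom, with $\sigma$ running through the (nonempty) subsimplices of $K$, is unisolvent for $\mathcal P_r\mathrm{Alt}^{k,\ell}(K)$; that is, it maps $\mathcal P_r\mathrm{Alt}^{k,\ell}(K)$ bijectively onto the product of the dual spaces of the test spaces. 1. $\langle\iota_\sigma^*\iota_\sigma^*\omega,b\rangle_\sigma$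 for all $b\in\mathcal B_r\mathrm{Alt}^{k,\ell}(\sigma)$ and all $\sigma$. 2. $\langle\iota_\sigma^*\jmath_\sigma^*\omega,b\rangle_\sigma$ for all $b\in\mathcal B_r\mathrm{Alt}^k(\sigma)\otimes\mathrm{Alt}^{m}(\sigma)\otimes\mathrm{Alt}^{\ell-m}(\sigma^\perp)$ (where $\mathrm{Alt}^m(\sigma)$ is the line of volume forms) and all $\sigma$ with $\dim\sigma=m\in[k,\ell]$, together with $\langle\iota_\sigma^*\iota_\sigma^*\omega,b\rangle_\sigma$ for all $b\in\mathcal B_r\mathrm{Alt}^{k,\ell}(\sigma)$ and all $\sigma$ with $\dim\sigma>\ell$. 3. $\langle\iota_\sigma^*\jmath_{\sigma,[p]}^*\omega,b\rangle_\sigma$ for all $b\in\bigoplus_{s=0}^{p-1}\mathcal B_r\mathrm{Alt}^k(\sigma)\otimes\bigl(\mathrm{Alt}^{m-s}(\sigma)\otimes\mathrm{Alt}^{\ell-m+s}(\sigma^\perp)\bigr)$ and all $\sigma$ with $\dim\sigma=m\in[k,\ell+p-1]$, together with $\langle\iota_\sigma^*\iota_\sigma^*\omega,b\rangle_\sigma$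 for all $b\in\mathcal B_r\mathrm{Alt}^{k,\ell}(\sigma)$ and all $\sigma$ with $\dim\sigma\ge\ell+p$. Moreover, let $\mathcal T$ be a triangulation (simplicial complex) in $\mathbb R^n$, and for each of the three groups consider the finite element space of all families $\omega=(\omega_K)$, $\omega_K\in\mathcal P_r\mathrm{Alt}^{k,\ell}(K)$ for each $n$-simplex $K$ of $\mathcal T$, such that for every simplex $\sigma$ common to $n$-simplices $K,K'$ of $\mathcal T$ the degrees of freedom on $\sigma$ of $\omega_K$ and $\omega_{K'}$ agree. These spaces, denoted $C_{\iota^*\iota^*}\mathcal P_r\mathrm{Alt}^{k,\ell}$, $C_{\iota^*\jmath^*}\mathcal P_r\mathrm{Alt}^{k,\ell}$, $C_{\iota^*\jmath^*_{[p]}}\mathcal P_r\mathrm{Alt}^{k,\ell}$, are conforming: for every $\omega$ in the space and all such $\sigma,K,K'$, the following traces are the same for $\omega_K$ and $\omega_{K'}$: (1) $\iota_\sigma^*\iota_\sigma^*$; (2) $\iota_\sigma^*\jmath_\sigma^*$ if $\dim\sigma\le\ell$, and $\iota_\sigma^*\iota_\sigma^*$ if $\dim\sigma\ge\ell$; (3)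 $\iota_\sigma^*\jmath_{\sigma,[p]}^*$ if $\dim\sigma\le\ell+p-1$, and $\iota_\sigma^*\iota_\sigma^*$ if $\dim\sigma\ge\ell+p$. -/

import Mathlib

open MeasureTheory
open scoped MeasureTheory

namespace FormValuedForm

noncomputable section

/-! ### Simplices

A simplex in `ℝⁿ` is given by its finite, nonempty, affinely independent set of vertices. -/

/-- Euclidean space `ℝⁿ`. -/
abbrev Eucl (n : ℕ) := EuclideanSpace ℝ (Fin n)

/-- The closed simplex with vertex set `σ`. -/
abbrev hull {n : ℕ} (σ : Finset (Eucl n)) : Set (Eucl n) := convexHull ℝ (σ : Set (Eucl n))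

/-- The tangent space of the simplex with vertex set `σ`. -/
abbrev tang {n : ℕ} (σ : Finset (Eucl n)) : Submodule ℝ (Eucl n) :=
  vectorSpan ℝ (σ : Set (Eucl n))

/-- The dimension of the simplex with (nonempty, affinely independent) vertex set `σ`. -/
abbrev sdim {n : ℕ} (σ : Finset (Eucl n)) : ℕ := σ.card - 1

/-- The nonempty subsimplices of `K`, including `K` itself. -/
abbrev Face {n : ℕ} (K : Finset (Eucl n)) := {σ : Finset (Eucl n) // σ ⊆ K ∧ σ.Nonempty}

lemma hull_mono {n : ℕ} {F σ : Finset (Eucl n)} (h : F ⊆ σ) : hull F ⊆ hull σ :=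
  convexHull_mono (Finset.coe_subset.2 h)

lemma tang_mono {n : ℕ} {F σ : Finset (Eucl n)} (h : F ⊆ σ) : tang F ≤ tang σ :=
  vectorSpan_mono ℝ (Finset.coe_subset.2 h)

/-! ### Form-valued forms and polynomial spaces -/

/-- `Alt^{k,ℓ}(V)`: alternating `k`-forms on `V` with values in the alternating `ℓ`-forms. -/
abbrev AltAlt (k ℓ : ℕ) (V : Type*) [AddCommGroup V] [Module ℝ V] :=
  V [⋀^Fin k]→ₗ[ℝ] (V [⋀^Fin ℓ]→ₗ[ℝ] ℝ)

/-- `P_r(S) ⊗ W`: the `W`-valued functions on `S ⊆ ℝⁿ` that are restrictions of polynomials of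
total degree at most `r`. -/
def polyMap {n : ℕ} (S : Set (Eucl n)) (r : ℕ) (W : Type*) [AddCommGroup W] [Module ℝ W] :
    Submodule ℝ (S → W) :=
  Submodule.span ℝ {f | ∃ (q : MvPolynomial (Fin n) ℝ) (w : W), q.totalDegree ≤ r ∧
    f = fun x : S => MvPolynomial.eval (fun i => (x : Eucl n) i) q • w}

/-- The shape function space `P_r Alt^{k,ℓ}(K)` on an `n`-simplex `K` in `ℝⁿ`. -/
abbrev shape {n : ℕ} (r k ℓ : ℕ) (K : Finset (Eucl n)) :
    Submodule ℝ (hull K → AltAlt k ℓ (Eucl n)) :=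
  polyMap (hull K) r (AltAlt k ℓ (Eucl n))

section Algebra

variable {V V' W : Type*} [AddCommGroup V] [Module ℝ V] [AddCommGroup V'] [Module ℝ V']
  [AddCommGroup W] [Module ℝ W]

/-- Pullback of alternating forms along a linear map. -/
def pull (k : ℕ) (W : Type*) [AddCommGroup W] [Module ℝ W] (g : V' →ₗ[ℝ] V) :
    (V [⋀^Fin k]→ₗ[ℝ] W) →ₗ[ℝ] (V' [⋀^Fin k]→ₗ[ℝ] W) where
  toFun f := f.compLinearMap g
  map_add' _ _ := rfl
  map_smul' _ _ := rfl

/-- Pullback of an alternating form along `g`, followed by a linear map `A` of the values. -/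
def pullMap (k : ℕ) {W' : Type*} [AddCommGroup W'] [Module ℝ W'] (g : V' →ₗ[ℝ] V)
    (A : W →ₗ[ℝ] W') : (V [⋀^Fin k]→ₗ[ℝ] W) →ₗ[ℝ] (V' [⋀^Fin k]→ₗ[ℝ] W') where
  toFun f := A.compAlternatingMap (f.compLinearMap g)
  map_add' _ _ := by ext; simp
  map_smul' _ _ := by ext; simp

/-- Given an alternating form in the slots `Fin a ⊕ Fin b`, insert vectors of the subspace `T` in
the first `a` slots and vectors of the subspace `N` in the last `b` slots. -/
def splitForm (T N : Submodule ℝ V) (a b : ℕ) (ω : V [⋀^Fin a ⊕ Fin b]→ₗ[ℝ] ℝ) :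
    T [⋀^Fin a]→ₗ[ℝ] (N [⋀^Fin b]→ₗ[ℝ] ℝ) where
  toFun u :=
    { toFun := fun w => ω (Sum.elim (T.subtype ∘ u) (N.subtype ∘ w))
      map_update_add' := by
        intro _ w j x y
        classical
        simp only [Function.comp_update, Sum.elim_update_right, map_add, ω.map_update_add]
      map_update_smul' := by
        intro _ w j c x
        classical
        simp only [Function.comp_update, Sum.elim_update_right, map_smul, ω.map_update_smul]
      map_eq_zero_of_eq' := by
        intro w i j h hij
        exact ω.map_eq_zero_of_eq _ (i := Sum.inr i) (j := Sum.inr j) (by simp [h])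
          (by simpa using hij) }
  map_update_add' := by
    intro _ u i x y
    classical
    ext w
    simp only [Function.comp_update, Sum.elim_update_left, map_add, AlternatingMap.coe_mk,
      MultilinearMap.coe_mk, ω.map_update_add, AlternatingMap.add_apply]
  map_update_smul' := by
    intro _ u i c x
    classical
    ext w
    simp only [Function.comp_update, Sum.elim_update_left, map_smul, AlternatingMap.coe_mk,
      MultilinearMap.coe_mk, ω.map_update_smul, AlternatingMap.smul_apply]
  map_eq_zero_of_eq' := by
    intro u i j h hij
    ext w
    exact ω.map_eq_zero_of_eq _ (i := Sum.inl i) (j := Sum.inl j) (by simp [h])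
      (by simpa using hij)

/-- The identification of the `ℓ` slots of a form with `q` first slots and `ℓ - q` last slots. -/
def slotEquiv {q ℓ : ℕ} (h : q ≤ ℓ) : Fin ℓ ≃ Fin q ⊕ Fin (ℓ - q) :=
  (finCongr (Nat.add_sub_of_le h).symm).trans finSumFinEquiv.symm

/-- The algebraic part of `ϑ*_{F,q}` on `ℓ`-forms, where `T` is the tangent space of `F` and `N` its
orthogonal complement: the component in `Alt^q(T) ⊗ Alt^{ℓ-q}(N)`, that is
`(u₁, …, u_q) ↦ (w₁, …, w_{ℓ-q}) ↦ ω(u₁, …, u_q, w₁, …, w_{ℓ-q})`. It is zero for `q > ℓ`. -/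
def theta (T N : Submodule ℝ V) (ℓ q : ℕ) :
    (V [⋀^Fin ℓ]→ₗ[ℝ] ℝ) →ₗ[ℝ] (T [⋀^Fin q]→ₗ[ℝ] (N [⋀^Fin (ℓ - q)]→ₗ[ℝ] ℝ)) where
  toFun ω := if h : q ≤ ℓ then splitForm T N q (ℓ - q) (ω.domDomCongr (slotEquiv h)) else 0
  map_add' ω η := by
    split_ifs
    · rfl
    · simp
  map_smul' c ω := by
    split_ifs
    · rfl
    · simp

end Algebra

/-! ### Traces between simplices -/

/-- `Alt^q(F) ⊗ Alt^{q'}(F^⊥)`. -/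
abbrev TanNor {n : ℕ} (q q' : ℕ) (σ : Finset (Eucl n)) :=
  tang σ [⋀^Fin q]→ₗ[ℝ] ((tang σ)ᗮ [⋀^Fin q']→ₗ[ℝ] ℝ)

/-- The trace `ι_F^*` of a `W`-valued `k`-form on the simplex `σ` to a subsimplex `F`. -/
def iotaFace {n : ℕ} (k : ℕ) (W : Type*) [AddCommGroup W] [Module ℝ W] {F σ : Finset (Eucl n)}
    (h : F ⊆ σ) :
    (hull σ → tang σ [⋀^Fin k]→ₗ[ℝ] W) →ₗ[ℝ] (hull F → tang F [⋀^Fin k]→ₗ[ℝ] W) where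
  toFun b x := pull k W (Submodule.inclusion (tang_mono h)) (b (Set.inclusion (hull_mono h) x))
  map_add' _ _ := rfl
  map_smul' _ _ := rfl

/-- The double trace `ι_F^* ι_F^*` of a `(k,ℓ)`-form on the simplex `σ` to a subsimplex `F`. -/
def iotaIotaFace {n : ℕ} (k ℓ : ℕ) {F σ : Finset (Eucl n)} (h : F ⊆ σ) :
    (hull σ → AltAlt k ℓ (tang σ)) →ₗ[ℝ] (hull F → AltAlt k ℓ (tang F)) where
  toFun b x := pullMap k (Submodule.inclusion (tang_mono h))
    (pull ℓ ℝ (Submodule.inclusion (tang_mono h))) (b (Set.inclusion (hull_mono h) x))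
  map_add' _ _ := by ext1; simp
  map_smul' _ _ := by ext1; simp

/-- The double trace `ι_σ^* ι_σ^*` of a `(k,ℓ)`-form on the `n`-simplex `K`. -/
def iotaIota {n k ℓ : ℕ} {σ K : Finset (Eucl n)} (h : σ ⊆ K)
    (ω : hull K → AltAlt k ℓ (Eucl n)) : hull σ → AltAlt k ℓ (tang σ) :=
  fun x => pullMap k (tang σ).subtype (pull ℓ ℝ (tang σ).subtype)
    (ω (Set.inclusion (hull_mono h) x))

/-- The trace `ι_σ^* ϑ_{σ,q}^*` of a `(k,ℓ)`-form on the `n`-simplex `K`. -/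
def iotaTheta {n k ℓ : ℕ} {σ K : Finset (Eucl n)} (h : σ ⊆ K) (q : ℕ)
    (ω : hull K → AltAlt k ℓ (Eucl n)) :
    hull σ → tang σ [⋀^Fin k]→ₗ[ℝ] TanNor q (ℓ - q) σ :=
  fun x => pullMap (W' := TanNor q (ℓ - q) σ) k (tang σ).subtype
    (theta (tang σ) (tang σ)ᗮ ℓ q) (ω (Set.inclusion (hull_mono h) x))

/-- The generalized trace `ι_σ^* j_σ^*`, where `j_σ^* = ϑ_{σ, dim σ}^*`. -/
def iotaJ {n k ℓ : ℕ} {σ K : Finset (Eucl n)} (h : σ ⊆ K)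
    (ω : hull K → AltAlt k ℓ (Eucl n)) :
    hull σ → tang σ [⋀^Fin k]→ₗ[ℝ] TanNor (sdim σ) (ℓ - sdim σ) σ :=
  iotaTheta h (sdim σ) ω

/-- The numbers `q` of tangential slots (with `0 ≤ q ≤ ℓ`) occurring in `j_{σ,[p]}^*` for `ℓ`-forms
on a simplex of dimension `m`: `q = m - s` with `0 ≤ s ≤ p - 1`. -/
def jIdx (ℓ m p : ℕ) : Finset ℕ := (Finset.range (ℓ + 1)).filter fun q => q ≤ m ∧ m < q + p

/-- The generalized trace `ι_σ^* j_{σ,[p]}^*`, where `j_{σ,[p]}^*` is the (direct) sum of the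
`ϑ_{σ,m-s}^*` for `m = dim σ` and `0 ≤ s ≤ p - 1`. -/
def iotaJp {n k ℓ : ℕ} (p : ℕ) {σ K : Finset (Eucl n)} (h : σ ⊆ K)
    (ω : hull K → AltAlt k ℓ (Eucl n)) (q : jIdx ℓ (sdim σ) p) :
    hull σ → tang σ [⋀^Fin k]→ₗ[ℝ] TanNor (q : ℕ) (ℓ - q) σ :=
  iotaTheta h q ω

/-! ### Bubble spaces -/

/-- The bubble space `B_r Alt^k(σ)`. -/
def bubble {n : ℕ} (r k : ℕ) (σ : Finset (Eucl n)) :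
    Submodule ℝ (hull σ → tang σ [⋀^Fin k]→ₗ[ℝ] ℝ) where
  carrier := {b | b ∈ polyMap (hull σ) r (tang σ [⋀^Fin k]→ₗ[ℝ] ℝ) ∧
    ∀ (F : Finset (Eucl n)) (hF : F ⊂ σ), F.Nonempty → iotaFace k ℝ hF.subset b = 0}
  add_mem' ha hb := ⟨add_mem ha.1 hb.1, fun F hF hn => by
    rw [map_add, ha.2 F hF hn, hb.2 F hF hn, add_zero]⟩
  zero_mem' := ⟨zero_mem _, fun _ _ _ => map_zero _⟩
  smul_mem' c _ hb := ⟨Submodule.smul_mem _ c hb.1, fun F hF hn => by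
    rw [map_smul, hb.2 F hF hn, smul_zero]⟩

/-- `B_r Alt^k(σ) ⊗ W` for a vector space `W` of constant coefficients, as `W`-valued `k`-forms. -/
def bubbleTensor {n : ℕ} (r k : ℕ) (σ : Finset (Eucl n)) (W : Type*) [AddCommGroup W]
    [Module ℝ W] : Submodule ℝ (hull σ → tang σ [⋀^Fin k]→ₗ[ℝ] W) :=
  Submodule.span ℝ {f | ∃ b ∈ bubble r k σ, ∃ w : W,
    f = fun x => (LinearMap.toSpanSingleton ℝ W w).compAlternatingMap (b x)}

/-- The bubble space `B_r Alt^{k,ℓ}(σ)` with respect to the double trace. -/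
def bubble₂ {n : ℕ} (r k ℓ : ℕ) (σ : Finset (Eucl n)) :
    Submodule ℝ (hull σ → AltAlt k ℓ (tang σ)) where
  carrier := {b | b ∈ polyMap (hull σ) r (AltAlt k ℓ (tang σ)) ∧
    ∀ (F : Finset (Eucl n)) (hF : F ⊂ σ), F.Nonempty → iotaIotaFace k ℓ hF.subset b = 0}
  add_mem' ha hb := ⟨add_mem ha.1 hb.1, fun F hF hn => by
    rw [map_add, ha.2 F hF hn, hb.2 F hF hn, add_zero]⟩
  zero_mem' := ⟨zero_mem _, fun _ _ _ => map_zero _⟩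
  smul_mem' c _ hb := ⟨Submodule.smul_mem _ c hb.1, fun F hF hn => by
    rw [map_smul, hb.2 F hF hn, smul_zero]⟩

/-- The test space `⊕_{s=0}^{p-1} B_r Alt^k(σ) ⊗ (Alt^{m-s}(σ) ⊗ Alt^{ℓ-m+s}(σ^⊥))`, `m = dim σ`. -/
abbrev testJp {n : ℕ} (r k ℓ p : ℕ) (σ : Finset (Eucl n)) :=
  ∀ q : jIdx ℓ (sdim σ) p, bubbleTensor r k σ (TanNor (q : ℕ) (ℓ - q) σ)

/-! ### Inner products -/

/-- The inner product on `Alt^k(V) ⊗ W` induced by the inner product of `V` and a bilinear form on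
`W`: the sum over increasing multi-indices with respect to an orthonormal basis of `V`. -/
def altInner {V W : Type*} [NormedAddCommGroup V] [InnerProductSpace ℝ V] [FiniteDimensional ℝ V]
    [AddCommGroup W] [Module ℝ W] {k : ℕ} (B : W → W → ℝ) (α β : V [⋀^Fin k]→ₗ[ℝ] W) : ℝ :=
  ∑ I : Fin k ↪o Fin (Module.finrank ℝ V),
    B (α (stdOrthonormalBasis ℝ V ∘ I)) (β (stdOrthonormalBasis ℝ V ∘ I))

/-- `⟨η, b⟩_σ` for `η, b` with values in `Alt^k(σ) ⊗ Alt^ℓ(σ)`: the pointwise inner product,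
integrated over `σ` with respect to the Euclidean measure of dimension `dim σ`. -/
def pair₂ {n k ℓ : ℕ} (σ : Finset (Eucl n)) (η b : hull σ → AltAlt k ℓ (tang σ)) : ℝ :=
  ∫ x, altInner (altInner fun s t : ℝ => s * t) (η x) (b x) ∂(μHE[sdim σ] : Measure (hull σ))

/-- `⟨η, b⟩_σ` for `η, b` with values in `Alt^k(σ) ⊗ Alt^q(σ) ⊗ Alt^{q'}(σ^⊥)`. -/
def pair₃ {n k q q' : ℕ} (σ : Finset (Eucl n))
    (η b : hull σ → tang σ [⋀^Fin k]→ₗ[ℝ] TanNor q q' σ) : ℝ :=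
  ∫ x, altInner (altInner (altInner fun s t : ℝ => s * t)) (η x) (b x)
    ∂(μHE[sdim σ] : Measure (hull σ))

/-- `⟨η, b⟩_σ` on the range of `ι_σ^* j_{σ,[p]}^*`, a direct sum of spaces. -/
def pairJp {n r k ℓ p : ℕ} (σ : Finset (Eucl n))
    (η : ∀ q : jIdx ℓ (sdim σ) p, hull σ → tang σ [⋀^Fin k]→ₗ[ℝ] TanNor (q : ℕ) (ℓ - q) σ)
    (b : testJp r k ℓ p σ) : ℝ :=
  ∑ q : jIdx ℓ (sdim σ) p, pair₃ σ (η q) (b q)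

/-! ### Unisolvence

A group of degrees of freedom is unisolvent for the shape function space if every prescription of
values, linear in the test functions on each subsimplex, is attained by exactly one shape function;
equivalently the shape function space is mapped bijectively onto the product of the duals of the
test spaces. -/

/-- Unisolvence of `⟨ι_σ^* ι_σ^* ω, b⟩_σ`, `b ∈ B_r Alt^{k,ℓ}(σ)`, for all `σ`. -/
def UnisolventII {n : ℕ} (r k ℓ : ℕ) (K : Finset (Eucl n)) : Prop :=
  ∀ L : ∀ σ : Face K, bubble₂ r k ℓ σ.1 →ₗ[ℝ] ℝ,
    ∃! ω : shape r k ℓ K, ∀ (σ : Face K) (b : bubble₂ r k ℓ σ.1),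
      pair₂ σ.1 (iotaIota σ.2.1 ω.1) b.1 = L σ b

/-- Unisolvence of `⟨ι_σ^* j_σ^* ω, b⟩_σ`, `b ∈ B_r Alt^k(σ) ⊗ Alt^m(σ) ⊗ Alt^{ℓ-m}(σ^⊥)`, for
`dim σ = m ∈ [k,ℓ]` (the line `Alt^m(σ)` is spanned by the volume form), together with
`⟨ι_σ^* ι_σ^* ω, b⟩_σ`, `b ∈ B_r Alt^{k,ℓ}(σ)`, for `dim σ > ℓ`. -/
def UnisolventIJ {n : ℕ} (r k ℓ : ℕ) (K : Finset (Eucl n)) : Prop :=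
  ∀ (L : ∀ σ : Face K, k ≤ sdim σ.1 → sdim σ.1 ≤ ℓ →
        bubbleTensor r k σ.1 (TanNor (sdim σ.1) (ℓ - sdim σ.1) σ.1) →ₗ[ℝ] ℝ)
    (M : ∀ σ : Face K, ℓ < sdim σ.1 → bubble₂ r k ℓ σ.1 →ₗ[ℝ] ℝ),
    ∃! ω : shape r k ℓ K,
      (∀ (σ : Face K) (h₁ : k ≤ sdim σ.1) (h₂ : sdim σ.1 ≤ ℓ)
        (b : bubbleTensor r k σ.1 (TanNor (sdim σ.1) (ℓ - sdim σ.1) σ.1)),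
        pair₃ σ.1 (iotaJ σ.2.1 ω.1) b.1 = L σ h₁ h₂ b) ∧
      ∀ (σ : Face K) (h : ℓ < sdim σ.1) (b : bubble₂ r k ℓ σ.1),
        pair₂ σ.1 (iotaIota σ.2.1 ω.1) b.1 = M σ h b

/-- Unisolvence of `⟨ι_σ^* j_{σ,[p]}^* ω, b⟩_σ`,
`b ∈ ⊕_{s=0}^{p-1} B_r Alt^k(σ) ⊗ (Alt^{m-s}(σ) ⊗ Alt^{ℓ-m+s}(σ^⊥))`, for
`dim σ = m ∈ [k,ℓ+p-1]`, together with `⟨ι_σ^* ι_σ^* ω, b⟩_σ`, `b ∈ B_r Alt^{k,ℓ}(σ)`, for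
`dim σ ≥ ℓ + p`. -/
def UnisolventIJp {n : ℕ} (r k ℓ p : ℕ) (K : Finset (Eucl n)) : Prop :=
  ∀ (L : ∀ σ : Face K, k ≤ sdim σ.1 → sdim σ.1 < ℓ + p → testJp r k ℓ p σ.1 →ₗ[ℝ] ℝ)
    (M : ∀ σ : Face K, ℓ + p ≤ sdim σ.1 → bubble₂ r k ℓ σ.1 →ₗ[ℝ] ℝ),
    ∃! ω : shape r k ℓ K,
      (∀ (σ : Face K) (h₁ : k ≤ sdim σ.1) (h₂ : sdim σ.1 < ℓ + p) (b : testJp r k ℓ p σ.1),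
        pairJp σ.1 (iotaJp p σ.2.1 ω.1) b = L σ h₁ h₂ b) ∧
      ∀ (σ : Face K) (h : ℓ + p ≤ sdim σ.1) (b : bubble₂ r k ℓ σ.1),
        pair₂ σ.1 (iotaIota σ.2.1 ω.1) b.1 = M σ h b

/-! ### Finite element spaces on a triangulation -/

/-- The `n`-simplices of a triangulation in `ℝⁿ`. -/
abbrev Cell {n : ℕ} (T : Geometry.SimplicialComplex ℝ (Eucl n)) :=
  {K : Finset (Eucl n) // K ∈ T.faces ∧ K.card = n + 1}

/-- Piecewise `(k,ℓ)`-forms: one form on each `n`-simplex of the triangulation. -/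
abbrev Piecewise {n : ℕ} (k ℓ : ℕ) (T : Geometry.SimplicialComplex ℝ (Eucl n)) :=
  ∀ K : Cell T, hull K.1 → AltAlt k ℓ (Eucl n)

section Spaces

variable {n : ℕ} (r k ℓ p : ℕ) (T : Geometry.SimplicialComplex ℝ (Eucl n))

/-- `C_{ι*ι*} P_r Alt^{k,ℓ}`: piecewise shape functions whose degrees of freedom of the `ι*ι*`
family on every simplex agree, whichever of the adjacent cells they are computed from. -/
def spaceII : Set (Piecewise k ℓ T) :=
  {ω | (∀ K, ω K ∈ shape r k ℓ K.1) ∧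
    ∀ (K K' : Cell T) (σ : Finset (Eucl n)) (h : σ ⊆ K.1) (h' : σ ⊆ K'.1), σ.Nonempty →
      ∀ b ∈ bubble₂ r k ℓ σ, pair₂ σ (iotaIota h (ω K)) b = pair₂ σ (iotaIota h' (ω K')) b}

/-- `C_{ι*j*} P_r Alt^{k,ℓ}`. -/
def spaceIJ : Set (Piecewise k ℓ T) :=
  {ω | (∀ K, ω K ∈ shape r k ℓ K.1) ∧
    ∀ (K K' : Cell T) (σ : Finset (Eucl n)) (h : σ ⊆ K.1) (h' : σ ⊆ K'.1), σ.Nonempty →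
      (k ≤ sdim σ → sdim σ ≤ ℓ →
        ∀ b ∈ bubbleTensor r k σ (TanNor (sdim σ) (ℓ - sdim σ) σ),
          pair₃ σ (iotaJ h (ω K)) b = pair₃ σ (iotaJ h' (ω K')) b) ∧
      (ℓ < sdim σ →
        ∀ b ∈ bubble₂ r k ℓ σ, pair₂ σ (iotaIota h (ω K)) b = pair₂ σ (iotaIota h' (ω K')) b)}

/-- `C_{ι*j*_{[p]}} P_r Alt^{k,ℓ}`. -/
def spaceIJp : Set (Piecewise k ℓ T) :=
  {ω | (∀ K, ω K ∈ shape r k ℓ K.1) ∧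
    ∀ (K K' : Cell T) (σ : Finset (Eucl n)) (h : σ ⊆ K.1) (h' : σ ⊆ K'.1), σ.Nonempty →
      (k ≤ sdim σ → sdim σ < ℓ + p →
        ∀ b : testJp r k ℓ p σ,
          pairJp σ (iotaJp p h (ω K)) b = pairJp σ (iotaJp p h' (ω K')) b) ∧
      (ℓ + p ≤ sdim σ →
        ∀ b ∈ bubble₂ r k ℓ σ, pair₂ σ (iotaIota h (ω K)) b = pair₂ σ (iotaIota h' (ω K')) b)}

/-- `ι*ι*`-conformity: the double trace is single-valued on every simplex. -/
def ConformingII (ω : Piecewise k ℓ T) : Prop :=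
  ∀ (K K' : Cell T) (σ : Finset (Eucl n)) (h : σ ⊆ K.1) (h' : σ ⊆ K'.1), σ.Nonempty →
    iotaIota h (ω K) = iotaIota h' (ω K')

/-- `ι*j*`-conformity: `ι*j*` is single-valued on the simplices of dimension at most `ℓ`, and
`ι*ι*` is single-valued on those of dimension at least `ℓ`. -/
def ConformingIJ (ω : Piecewise k ℓ T) : Prop :=
  ∀ (K K' : Cell T) (σ : Finset (Eucl n)) (h : σ ⊆ K.1) (h' : σ ⊆ K'.1), σ.Nonempty →
    (sdim σ ≤ ℓ → iotaJ h (ω K) = iotaJ h' (ω K')) ∧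
    (ℓ ≤ sdim σ → iotaIota h (ω K) = iotaIota h' (ω K'))

/-- `ι*j*_{[p]}`-conformity: `ι*j*_{[p]}` is single-valued on the simplices of dimension at most
`ℓ + p - 1`, and `ι*ι*` is single-valued on those of dimension at least `ℓ + p`. -/
def ConformingIJp (ω : Piecewise k ℓ T) : Prop :=
  ∀ (K K' : Cell T) (σ : Finset (Eucl n)) (h : σ ⊆ K.1) (h' : σ ⊆ K'.1), σ.Nonempty →
    (sdim σ < ℓ + p → iotaJp p h (ω K) = iotaJp p h' (ω K')) ∧
    (ℓ + p ≤ sdim σ → iotaIota h (ω K) = iotaIota h' (ω K'))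

end Spaces

end

end FormValuedForm

namespace FormValuedForm

noncomputable section

open scoped Classical

/-! ### Polynomial maps -/

section PolyMap

variable {n r : ℕ} {S S' : Set (Eucl n)} {W W' : Type*} [AddCommGroup W] [Module ℝ W]
  [AddCommGroup W'] [Module ℝ W']

/-! All three families are one: for `p = 0` the index set `jIdx` is empty and the third family is
the first (simplices of dimension below ℓ carry no double-trace bubbles), and `p = 1` gives the
second. Unisolvence is injectivity plus a dimension bound, and conformity follows from the same
vanishing argument as injectivity.

Vanishing (`traces_eq_zero`) is by induction over subsimplices. Suppose the traces vanish on the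
proper faces of σ, with m = dim σ. Each component ι*ϑ_q with m - q < p then restricts to zero on
every such face F: split q tangent vectors of σ into q' vectors tangent to F and q - q' tangent to σ
but normal to F. At most dim σ - dim F independent vectors are of the second kind, so dim F - q' ≤ m
- q < p, and the ϑ_{q'} component on F, zero by induction, is what is being evaluated. Thus the
component is a bubble, is tested against itself, and is zero. In dimension at least ℓ + p the double
trace is likewise a bubble tested against itself; in dimensions from ℓ to ℓ + p - 1 it is the
component ϑ_ℓ; below ℓ it is zero. On σ = K the double trace is ω itself.

Dimension bound. A polynomial of degree at most r on σ is uniquely a homogeneous polynomial of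
degree r in the barycentric coordinates (`synthEquiv`). For each exponent α fix a vertex v in its
support; since r ≥ 1 there is one. A form-valued coefficient at α is determined by its values on
sets I of edges issuing from v. For a bubble, restriction to the face spanned by supp α ∪ I kills
the value unless this face is σ. So a bubble space has dimension at most the number of (α, I) with
supp α ∪ I = σ, or of (α, I, J) with supp α ∪ I ∪ J = σ for the double trace. Summed over σ, each
(α, I) on K, with S = supp α ∪ I, contributes the sets J of ℓ vertices other than v for which |J ∩
S| is an admissible q, and those for which dim(S ∪ J) ≥ ℓ + p. Since dim(S ∪ J) = dim S + ℓ - |J ∩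
S|, no J is counted twice, so the total is at most the dimension of the shape space (`sum_dof_le`).
Upper bounds on the bubble dimensions suffice: an injection into a space of no larger dimension is
bijective.

Conformity. Extend ω_{K'} as a polynomial form to K. Its difference from ω_K has zero degrees of
freedom on every subsimplex of σ, and `traces_eq_zero`, which uses only those subsimplices, makes
its traces on σ vanish. -/

lemma polyMap_linear_comp (A : W →ₗ[ℝ] W') {f : S → W} (hf : f ∈ polyMap S r W) :
    (fun x => A (f x)) ∈ polyMap S r W' := by
  induction hf using Submodule.span_induction with
  | mem f h =>
    obtain ⟨q, w, hq, rfl⟩ := h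
    exact Submodule.subset_span ⟨q, A w, hq, by simp⟩
  | zero =>
    have h : (fun x : S => A ((0 : S → W) x)) = 0 := funext fun _ => map_zero A
    rw [h]
    exact zero_mem _
  | add f g _ _ hf hg =>
    have h : (fun x => A ((f + g) x)) = (fun x => A (f x)) + fun x => A (g x) :=
      funext fun _ => map_add A _ _
    rw [h]
    exact add_mem hf hg
  | smul c f _ hf =>
    have h : (fun x => A ((c • f) x)) = c • fun x => A (f x) := funext fun _ => map_smul A _ _
    rw [h]
    exact Submodule.smul_mem _ c hf

lemma polyMap_restrict (h : S' ⊆ S) {f : S → W} (hf : f ∈ polyMap S r W) :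
    (fun x : S' => f (Set.inclusion h x)) ∈ polyMap S' r W := by
  induction hf using Submodule.span_induction with
  | mem f h =>
    obtain ⟨q, w, hq, rfl⟩ := h
    exact Submodule.subset_span ⟨q, w, hq, rfl⟩
  | zero => exact zero_mem (polyMap S' r W)
  | add f g _ _ hf hg => exact add_mem hf hg
  | smul c f _ hf => exact Submodule.smul_mem _ c hf

/-- A polynomial map on `S` agrees on `S ∩ S'` with a polynomial map on `S'`. -/
lemma exists_polyMap_eq_on_inter (S' : Set (Eucl n)) {f : S → W} (hf : f ∈ polyMap S r W) :
    ∃ g ∈ polyMap S' r W, ∀ (x : Eucl n) (h : x ∈ S) (h' : x ∈ S'), g ⟨x, h'⟩ = f ⟨x, h⟩ := by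
  induction hf using Submodule.span_induction with
  | mem f h =>
    obtain ⟨q, w, hq, rfl⟩ := h
    exact ⟨_, Submodule.subset_span ⟨q, w, hq, rfl⟩, fun _ _ _ => rfl⟩
  | zero => exact ⟨0, zero_mem _, fun _ _ _ => rfl⟩
  | add f g _ _ hf hg =>
    obtain ⟨f', hf', hf''⟩ := hf
    obtain ⟨g', hg', hg''⟩ := hg
    exact ⟨f' + g', add_mem hf' hg', fun x h h' => by simp [hf'' x h h', hg'' x h h']⟩
  | smul c f _ hf =>
    obtain ⟨f', hf', hf''⟩ := hf
    exact ⟨c • f', Submodule.smul_mem _ c hf', fun x h h' => by simp [hf'' x h h']⟩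

/-- The value space carries no topology, so continuity is expressed after applying a functional. -/
lemma continuous_of_mem_polyMap (φ : W →ₗ[ℝ] ℝ) {f : S → W} (hf : f ∈ polyMap S r W) :
    Continuous fun x => φ (f x) := by
  induction hf using Submodule.span_induction with
  | mem f h =>
    obtain ⟨q, w, hq, rfl⟩ := h
    simp only [map_smul, smul_eq_mul]
    refine Continuous.mul ?_ continuous_const
    refine (MvPolynomial.continuous_eval q).comp (continuous_pi fun i => ?_)
    fun_prop
  | zero => simpa using continuous_const
  | add f g _ _ hf hg =>
    simp only [Pi.add_apply, map_add]
    exact Continuous.add hf hg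
  | smul c f _ hf =>
    simp only [Pi.smul_apply, map_smul]
    exact Continuous.const_smul hf c

end PolyMap

/-! ### Barycentric coordinates -/

section Bary

variable {n r : ℕ} {K σ F : Finset (Eucl n)} {W : Type*} [AddCommGroup W] [Module ℝ W]

/-- The affine functions `lam v`, `v ∈ K`, are dual to the points of `K`. -/
def IsBary (K : Finset (Eucl n)) (lam : Eucl n → Eucl n →ᵃ[ℝ] ℝ) : Prop :=
  ∀ v ∈ K, ∀ w ∈ K, lam v w = if v = w then 1 else 0

lemma exists_isBary (hK : AffineIndependent ℝ ((↑) : K → Eucl n)) (hc : K.card = n + 1) :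
    ∃ lam, IsBary K lam := by
  have hspan : affineSpan ℝ (Set.range ((↑) : K → Eucl n)) = ⊤ := by
    rw [hK.affineSpan_eq_top_iff_card_eq_finrank_add_one]
    simp [hc]
  let b : AffineBasis K ℝ (Eucl n) := ⟨(↑), hK, hspan⟩
  refine ⟨fun v => if h : v ∈ K then b.coord ⟨v, h⟩ else 0, fun v hv w hw => ?_⟩
  have := b.coord_apply ⟨v, hv⟩ ⟨w, hw⟩
  simp only [Subtype.mk.injEq] at this
  rw [← this]
  simp [hv]
  rfl

variable {lam : Eucl n → Eucl n →ᵃ[ℝ] ℝ}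

/-- One family of affine functions on the ambient space serves a simplex and all its faces, so the
barycentric monomials of a face are restrictions of those of the simplex. -/
lemma IsBary.mono (h : IsBary K lam) (hσ : σ ⊆ K) : IsBary σ lam :=
  fun v hv w hw => h v (hσ hv) w (hσ hw)

lemma affineMap_sum_smul (f : Eucl n →ᵃ[ℝ] ℝ) {t : Eucl n → ℝ} (ht : ∑ w ∈ K, t w = 1) :
    f (∑ w ∈ K, t w • w) = ∑ w ∈ K, t w * f w := by
  have h := Finset.map_affineCombination K id t ht f
  rw [Finset.affineCombination_eq_linear_combination _ _ _ ht,
    Finset.affineCombination_eq_linear_combination _ _ _ ht] at h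
  simpa using h

lemma IsBary.sum (h : IsBary K lam) {t : Eucl n → ℝ} (ht : ∑ w ∈ K, t w = 1) {v : Eucl n}
    (hv : v ∈ K) : lam v (∑ w ∈ K, t w • w) = t v := by
  rw [affineMap_sum_smul _ ht, Finset.sum_congr rfl (g := fun w => if v = w then t w else 0)]
  · simp [hv]
  · intro w hw
    simp [h v hv w hw]

lemma IsBary.of_mem_hull (h : IsBary K lam) {x : Eucl n} (hx : x ∈ hull K) :
    (∑ v ∈ K, lam v x = 1) ∧ ∑ v ∈ K, lam v x • v = x := by
  obtain ⟨t, -, h1, rfl⟩ := Finset.mem_convexHull'.1 hx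
  have : ∀ v ∈ K, lam v (∑ w ∈ K, t w • w) = t v := fun v hv => h.sum h1 hv
  constructor
  · rw [Finset.sum_congr rfl this, h1]
  · exact Finset.sum_congr rfl fun v hv => by rw [this v hv]

lemma IsBary.eq_zero (h : IsBary K lam) (hF : F ⊆ K) {x : Eucl n} (hx : x ∈ hull F) {v : Eucl n}
    (hv : v ∈ K) (hvF : v ∉ F) : lam v x = 0 := by
  obtain ⟨t, -, h1, rfl⟩ := Finset.mem_convexHull'.1 hx
  rw [affineMap_sum_smul _ h1]
  refine Finset.sum_eq_zero fun w hw => ?_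
  have : v ≠ w := fun e => hvF (e ▸ hw)
  simp [h v hv w (hF hw), this]

/-- The monomial in the barycentric coordinates with exponent `α`. -/
def mono (lam : Eucl n → Eucl n →ᵃ[ℝ] ℝ) (α : Eucl n →₀ ℕ) (x : Eucl n) : ℝ :=
  α.prod fun v e => lam v x ^ e

/-- The homogeneous exponents of degree `r` supported in `σ`. -/
abbrev expo (σ : Finset (Eucl n)) (r : ℕ) : Finset (Eucl n →₀ ℕ) := Finset.finsuppAntidiag σ r

lemma expo_mono (h : F ⊆ σ) : expo F r ⊆ expo σ r := Finset.finsuppAntidiag_mono h r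

lemma mem_expo_of_support {α : Eucl n →₀ ℕ} (h : α ∈ expo σ r) (hF : α.support ⊆ F) :
    α ∈ expo F r := by
  rw [Finset.mem_finsuppAntidiag'] at *
  exact ⟨h.1, hF⟩

lemma mono_eq_zero (h : IsBary K lam) (hF : F ⊆ K) {x : Eucl n} (hx : x ∈ hull F)
    {α : Eucl n →₀ ℕ} (hα : α ∈ expo K r) (hαF : ¬ α.support ⊆ F) : mono lam α x = 0 := by
  obtain ⟨v, hv, hvF⟩ := Finset.not_subset.1 hαF
  refine Finset.prod_eq_zero hv ?_
  beta_reduce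
  rw [h.eq_zero hF hx ((Finset.mem_finsuppAntidiag.1 hα).2 hv) hvF]
  exact zero_pow (by simpa using hv)

/-- On the simplex the barycentric coordinates sum to 1, but homogeneity lets arbitrary positive
values be rescaled to that case. The relation thus becomes a polynomial in free variables vanishing
on a positive orthant. -/
lemma eq_zero_of_sum_mono_eq_zero (h : IsBary σ lam) (hσ : σ.Nonempty)
    {c : (Eucl n →₀ ℕ) → W} (hc : ∀ x ∈ hull σ, ∑ α ∈ expo σ r, mono lam α x • c α = 0) :
    ∀ α ∈ expo σ r, c α = 0 := by
  intro α hα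
  rw [← Module.forall_dual_apply_eq_zero_iff ℝ]
  intro φ
  let P : MvPolynomial (Eucl n) ℝ := ∑ β ∈ expo σ r, MvPolynomial.monomial β (φ (c β))
  have hP : P = 0 := by
    refine MvPolynomial.funext_set (fun _ => Set.Ioi 0) (fun _ => Set.Ioi_infinite _) fun t ht => ?_
    have ht' : ∀ v, 0 < t v := fun v => ht v trivial
    have hT : 0 < ∑ v ∈ σ, t v := Finset.sum_pos (fun v _ => ht' v) hσ
    set T := ∑ v ∈ σ, t v with hTdef
    have hsum : ∑ v ∈ σ, t v / T = 1 := by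
      rw [← Finset.sum_div, ← hTdef, div_self hT.ne']
    have hx : ∑ v ∈ σ, (t v / T) • v ∈ hull σ :=
      Finset.mem_convexHull'.2 ⟨fun v => t v / T, fun v _ => (div_pos (ht' v) hT).le, hsum, rfl⟩
    have := congrArg φ (hc _ hx)
    simp only [map_sum, map_smul, smul_eq_mul, map_zero] at this
    -- Every exponent has total degree r, so scaling t by 1/T multiplies each monomial by the same
    -- power of T.
    have key : ∀ β ∈ expo σ r, MvPolynomial.eval t (MvPolynomial.monomial β (φ (c β))) =
        T ^ r * (mono lam β (∑ v ∈ σ, (t v / T) • v) * φ (c β)) := by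
      intro β hβ
      obtain ⟨h1, h2⟩ := Finset.mem_finsuppAntidiag'.1 hβ
      rw [MvPolynomial.eval_monomial, ← mul_assoc, mul_comm]
      congr 1
      rw [← h1, mono, Finsupp.prod, Finsupp.prod, Finsupp.sum, ← Finset.prod_pow_eq_pow_sum,
        ← Finset.prod_mul_distrib]
      refine Finset.prod_congr rfl fun v hv => ?_
      rw [h.sum hsum (h2 hv), ← mul_pow, mul_div_cancel₀ _ hT.ne']
    simp only [P, map_sum, map_zero]
    rw [Finset.sum_congr rfl key, ← Finset.mul_sum, this, mul_zero]
  have := congrArg (MvPolynomial.coeff α) hP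
  simpa only [P, MvPolynomial.coeff_sum, MvPolynomial.coeff_monomial, Finset.sum_ite_eq', hα,
    if_true, MvPolynomial.coeff_zero] using this

lemma exists_affine_mvPolynomial (f : Eucl n →ᵃ[ℝ] ℝ) :
    ∃ q : MvPolynomial (Fin n) ℝ, q.totalDegree ≤ 1 ∧
      ∀ x : Eucl n, MvPolynomial.eval (fun i => x i) q = f x := by
  refine ⟨∑ i, MvPolynomial.C (f.linear (EuclideanSpace.single i 1)) * MvPolynomial.X i +
    MvPolynomial.C (f 0), ?_, fun x => ?_⟩
  · refine (MvPolynomial.totalDegree_add _ _).trans (max_le ?_ (by simp))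
    refine MvPolynomial.totalDegree_finsetSum_le fun i _ => ?_
    refine (MvPolynomial.totalDegree_mul _ _).trans (by simp)
  · have hx : x = ∑ i, x i • EuclideanSpace.single i (1 : ℝ) := by
      have := (EuclideanSpace.basisFun (Fin n) ℝ).sum_repr x
      simpa using this.symm
    have hf : f x = f.linear x + f 0 := by
      have := f.map_vadd 0 x
      simpa using this
    rw [hf]
    conv_rhs => rw [hx]
    simp [mul_comm]

lemma mono_smul_mem {α : Eucl n →₀ ℕ}
    (h : α ∈ expo σ r) (w : W) (S : Set (Eucl n)) :
    (fun x : S => mono lam α x • w) ∈ polyMap S r W := by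
  choose q hq1 hq2 using fun v => exists_affine_mvPolynomial (lam v)
  refine Submodule.subset_span ⟨α.prod fun v e => q v ^ e, w, ?_, ?_⟩
  · rw [← (Finset.mem_finsuppAntidiag'.1 h).1]
    refine (MvPolynomial.totalDegree_finsetProd _ _).trans (Finset.sum_le_sum fun v _ => ?_)
    refine (MvPolynomial.totalDegree_pow _ _).trans ?_
    simpa using Nat.mul_le_mul_left (α v) (hq1 v)
  · funext x
    simp [mono, Finsupp.prod, map_prod, hq2]

/-- The `W`-valued polynomial on `hull σ` with given coefficients in the barycentric monomials. -/
def synth (lam : Eucl n → Eucl n →ᵃ[ℝ] ℝ) (σ : Finset (Eucl n)) (r : ℕ) (W : Type*)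
    [AddCommGroup W] [Module ℝ W] : (expo σ r → W) →ₗ[ℝ] (hull σ → W) where
  toFun c x := ∑ α : expo σ r, mono lam α x • c α
  map_add' c d := by
    funext x
    simp [Finset.sum_add_distrib]
  map_smul' a c := by
    funext x
    simp [Finset.smul_sum, smul_comm a]

lemma synth_apply (c : expo σ r → W) (x : hull σ) :
    synth lam σ r W c x = ∑ α : expo σ r, mono lam α x • c α := rfl

lemma synth_injective (h : IsBary σ lam) (hσ : σ.Nonempty) :
    Function.Injective (synth lam σ r W) := by
  rw [← LinearMap.ker_eq_bot, LinearMap.ker_eq_bot']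
  intro c hc
  have := eq_zero_of_sum_mono_eq_zero (r := r) (W := W) h hσ
    (c := fun α => if h : α ∈ expo σ r then c ⟨α, h⟩ else 0) fun x hx => by
      rw [← Finset.sum_attach]
      have h1 := congrFun hc ⟨x, hx⟩
      rw [synth_apply] at h1
      simpa using h1
  funext α
  simpa using this α α.2

lemma synth_mem_polyMap (c : expo σ r → W) : synth lam σ r W c ∈ polyMap (hull σ) r W := by
  have : synth lam σ r W c = ∑ α : expo σ r, fun x : hull σ => mono lam α x • c α := by
    funext x
    simp [synth_apply]
  rw [this]
  exact Submodule.sum_mem _ fun α _ => mono_smul_mem α.2 _ _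

lemma exists_homogeneous_of_monomial (h : IsBary σ lam) (s : Fin n →₀ ℕ) (hs : s.degree ≤ r) :
    ∃ H : MvPolynomial (Eucl n) ℝ, H.IsHomogeneous r ∧
      H ∈ MvPolynomial.supported ℝ (σ : Set (Eucl n)) ∧
      ∀ x ∈ hull σ, MvPolynomial.eval (fun v => lam v x) H = s.prod fun i e => x i ^ e := by
  -- Each coordinate is x_i = Σ v_i λ_v on the simplex; powers of Σ λ_v = 1 raise the degree to
  -- exactly r.
  refine ⟨(s.prod fun i e => (∑ v ∈ σ, MvPolynomial.C (v i) * MvPolynomial.X v) ^ e) *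
    (∑ v ∈ σ, MvPolynomial.X v) ^ (r - s.degree), ?_, ?_, fun x hx => ?_⟩
  · have h1 : (s.prod fun i e => (∑ v ∈ σ, MvPolynomial.C (v i) *
        (MvPolynomial.X v : MvPolynomial (Eucl n) ℝ)) ^ e).IsHomogeneous s.degree := by
      refine MvPolynomial.IsHomogeneous.prod _ _ _ fun i _ => ?_
      have := (MvPolynomial.IsHomogeneous.sum σ
        (fun v : Eucl n => MvPolynomial.C (v i) * (MvPolynomial.X v : MvPolynomial (Eucl n) ℝ)) 1
        fun v _ => (MvPolynomial.isHomogeneous_C_mul_X (v i) v)).pow (s i)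
      simpa using this
    have h2 : ((∑ v ∈ σ, (MvPolynomial.X v : MvPolynomial (Eucl n) ℝ)) ^
        (r - s.degree)).IsHomogeneous (r - s.degree) := by
      have := (MvPolynomial.IsHomogeneous.sum σ
        (fun v : Eucl n => (MvPolynomial.X v : MvPolynomial (Eucl n) ℝ)) 1
        fun v _ => MvPolynomial.isHomogeneous_X _ v).pow (r - s.degree)
      simpa using this
    have := h1.mul h2
    rwa [Nat.add_sub_cancel' hs] at this
  · have hX : ∀ v ∈ σ, (MvPolynomial.X v : MvPolynomial (Eucl n) ℝ) ∈
        MvPolynomial.supported ℝ (σ : Set (Eucl n)) := fun v hv => by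
      simpa [MvPolynomial.X_mem_supported] using hv
    refine mul_mem (prod_mem fun i _ => pow_mem (sum_mem fun v hv => ?_) _)
      (pow_mem (sum_mem hX) _)
    exact mul_mem (Subalgebra.algebraMap_mem _ _) (hX v hv)
  · obtain ⟨h1, h2⟩ := h.of_mem_hull hx
    rw [map_mul, map_pow, map_sum, Finsupp.prod, map_prod]
    simp only [MvPolynomial.eval_X, h1, one_pow, mul_one]
    refine Finset.prod_congr rfl fun i _ => ?_
    have := congrArg (fun y : Eucl n => y i) h2
    simp only [PiLp.smul_apply, WithLp.ofLp_sum, Finset.sum_apply, smul_eq_mul] at this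
    simp [← this, mul_comm]

lemma range_synth (h : IsBary σ lam) :
    LinearMap.range (synth lam σ r W) = polyMap (hull σ) r W := by
  refine le_antisymm ?_ (Submodule.span_le.2 ?_)
  · rintro _ ⟨c, rfl⟩
    exact synth_mem_polyMap c
  · rintro _ ⟨q, w, hq, rfl⟩
    have : (fun x : hull σ => MvPolynomial.eval (fun i => (x : Eucl n) i) q • w) =
        ∑ s ∈ q.support, MvPolynomial.coeff s q •
          fun x : hull σ => (s.prod fun i e => (x : Eucl n) i ^ e) • w := by
      funext x
      rw [MvPolynomial.eval_eq, Finset.sum_smul]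
      simp [mul_smul, Finsupp.prod]
    rw [this]
    refine Submodule.sum_mem _ fun s hs => Submodule.smul_mem _ _ ?_
    obtain ⟨H, hH, hsupp, he⟩ := exists_homogeneous_of_monomial (r := r) h s
      ((MvPolynomial.le_totalDegree hs).trans hq)
    refine ⟨fun α => H.coeff α • w, ?_⟩
    funext x
    rw [synth_apply, ← he x x.2, MvPolynomial.eval_eq, Finset.sum_smul,
      Finset.sum_coe_sort (expo σ r) fun α => mono lam α x • H.coeff α • w]
    symm
    refine (Finset.sum_subset (fun α hα => ?_) fun α _ hα => ?_).trans
      (Finset.sum_congr rfl fun α hα => ?_)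
    · rw [Finset.mem_finsuppAntidiag']
      refine ⟨?_, fun v hv => ?_⟩
      · have := hH (MvPolynomial.mem_support_iff.1 hα)
        rw [← this, Finsupp.weight_apply]
        simp
      · rw [MvPolynomial.mem_supported] at hsupp
        exact hsupp ((MvPolynomial.mem_vars_iff_mem_support _).2 ⟨α, hα, hv⟩)
    · rw [MvPolynomial.notMem_support_iff.1 hα, zero_mul, zero_smul]
    · rw [smul_smul, mul_comm]
      rfl

/-- Polynomials on a simplex are the same as their barycentric coefficients. -/
def synthEquiv (h : IsBary σ lam) (hσ : σ.Nonempty) (r : ℕ) (W : Type*)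
    [AddCommGroup W] [Module ℝ W] : (expo σ r → W) ≃ₗ[ℝ] polyMap (hull σ) r W :=
  (LinearEquiv.ofInjective _ (synth_injective h hσ)).trans (LinearEquiv.ofEq _ _ (range_synth h))

end Bary

/-! ### Alternating forms -/

section Alternating

variable {V W : Type*} [AddCommGroup V] [Module ℝ V] [AddCommGroup W] [Module ℝ W]

instance finite_alternatingMap [Module.Finite ℝ V] [Module.Finite ℝ W] (k : ℕ) :
    Module.Finite ℝ (V [⋀^Fin k]→ₗ[ℝ] W) :=
  Module.Finite.equiv exteriorPower.alternatingMapLinearEquiv.symm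

lemma finrank_alternatingMap [Module.Finite ℝ V] [Module.Finite ℝ W] (k : ℕ) :
    Module.finrank ℝ (V [⋀^Fin k]→ₗ[ℝ] W) =
      (Module.finrank ℝ V).choose k * Module.finrank ℝ W := by
  rw [exteriorPower.alternatingMapLinearEquiv.finrank_eq, Module.finrank_linearMap,
    exteriorPower.finrank_eq]

lemma alternatingMap_subsingleton [Module.Finite ℝ V] {k : ℕ} (h : Module.finrank ℝ V < k) :
    Subsingleton (V [⋀^Fin k]→ₗ[ℝ] W) := by
  refine ⟨fun f g => (Module.finBasis ℝ V).ext_alternating fun v hv => ?_⟩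
  have := Fintype.card_le_of_injective v hv
  simp at this
  omega

/-- An alternating map vanishes as soon as it vanishes on one enumeration of each set of `k`
basis vectors. -/
lemma alternatingMap_eq_zero {ι : Type*} (e : Module.Basis ι ℝ V) {k : ℕ}
    (w : V [⋀^Fin k]→ₗ[ℝ] W)
    (h : ∀ I : Finset ι, I.card = k →
      ∃ j : Fin k → ι, Function.Injective j ∧ Set.range j = I ∧ w (fun i => e (j i)) = 0) :
    w = 0 := by
  refine e.ext_alternating fun v hv => ?_
  obtain ⟨j, hj, hr, h0⟩ := h (Finset.univ.image v) (by simp [Finset.card_image_of_injective _ hv])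
  have hr' : Set.range v = Set.range j := by rw [hr]; simp
  -- Two injective enumerations of the same set differ by a permutation, which changes the value of
  -- `w` only by a sign.
  let π : Equiv.Perm (Fin k) :=
    (Equiv.ofInjective v hv).trans ((Equiv.setCongr hr').trans (Equiv.ofInjective j hj).symm)
  have hπ : ∀ i, j (π i) = v i := fun i => by
    have := (Equiv.ofInjective j hj).apply_symm_apply (Equiv.setCongr hr' (Equiv.ofInjective v hv i))
    exact congrArg Subtype.val this
  have := w.map_perm (fun i => e (j i)) π
  simp only [Function.comp_def, hπ] at this
  rw [this, h0, smul_zero, AlternatingMap.zero_apply]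

lemma theta_apply {T N : Submodule ℝ V} {ℓ q : ℕ} (h : q ≤ ℓ) (w : V [⋀^Fin ℓ]→ₗ[ℝ] ℝ)
    (u : Fin q → T) (z : Fin (ℓ - q) → N) :
    theta T N ℓ q w u z = w fun i => Sum.elim (T.subtype ∘ u) (N.subtype ∘ z) (slotEquiv h i) := by
  simp only [theta, LinearMap.coe_mk, AddHom.coe_mk, dif_pos h]
  rfl

/-- If the component of `w` with `q` arguments in `T` and the others in `N` vanishes, then so does
`w` on all tuples of this kind, in whatever order. -/
lemma apply_eq_zero_of_theta {T N : Submodule ℝ V} {ℓ q : ℕ} {w : V [⋀^Fin ℓ]→ₗ[ℝ] ℝ}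
    (hw : theta T N ℓ q w = 0) (y : Fin ℓ → V) (s : Finset (Fin ℓ)) (hs : s.card = q)
    (hT : ∀ i ∈ s, y i ∈ T) (hN : ∀ i ∉ s, y i ∈ N) : w y = 0 := by
  have hq : q ≤ ℓ := by
    rw [← hs]
    simpa using Finset.card_le_univ s
  have hc : sᶜ.card = ℓ - q := by rw [Finset.card_compl, hs, Fintype.card_fin]
  let e := finSumEquivOfFinset hs hc
  -- π moves the slots in `s` to the front, the order in which `theta` takes its arguments; the cost
  -- is a sign.
  let π : Equiv.Perm (Fin ℓ) := (slotEquiv hq).trans e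
  have hl : ∀ i, e (Sum.inl i) ∈ s := fun i => by
    simp only [e, finSumEquivOfFinset_inl]
    exact Finset.orderEmbOfFin_mem _ _ _
  have hr : ∀ i, e (Sum.inr i) ∉ s := fun i => by
    simp only [e, finSumEquivOfFinset_inr]
    exact Finset.mem_compl.1 (Finset.orderEmbOfFin_mem _ _ _)
  have h1 := theta_apply hq w (fun i => ⟨y (e (Sum.inl i)), hT _ (hl i)⟩ : Fin q → T)
    (fun i => ⟨y (e (Sum.inr i)), hN _ (hr i)⟩ : Fin (ℓ - q) → N)
  have h2 : (fun i => Sum.elim (T.subtype ∘ (fun i => ⟨y (e (Sum.inl i)), hT _ (hl i)⟩ : Fin q → T))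
      (N.subtype ∘ (fun i => ⟨y (e (Sum.inr i)), hN _ (hr i)⟩ : Fin (ℓ - q) → N))
      (slotEquiv hq i)) = y ∘ π := by
    funext i
    simp only [π, Function.comp_apply, Equiv.trans_apply]
    cases slotEquiv hq i <;> rfl
  rw [h2, w.map_perm, hw] at h1
  have h3 : Equiv.Perm.sign π • w y = 0 := h1.symm
  exact (smul_eq_zero_iff_eq _).1 h3

end Alternating

/-! ### Tangential-normal components on a subspace and on a larger one -/

section InnerProduct

variable {V : Type*} [NormedAddCommGroup V] [InnerProductSpace ℝ V] [FiniteDimensional ℝ V]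

lemma mem_jIdx {ℓ m p q : ℕ} : q ∈ jIdx ℓ m p ↔ q ≤ ℓ ∧ q ≤ m ∧ m < q + p := by
  simp [jIdx]

/-- A basis of `T` each of whose elements lies in the subspace `T'` or in its orthogonal
complement. -/
lemma exists_adapted_basis {T' T : Submodule ℝ V} (h : T' ≤ T) :
    ∃ (a c : ℕ) (e : Module.Basis (Fin a ⊕ Fin c) ℝ T), a = Module.finrank ℝ T' ∧
      a + c = Module.finrank ℝ T ∧ (∀ i, (e (Sum.inl i) : V) ∈ T') ∧
      ∀ i, (e (Sum.inr i) : V) ∈ T'ᗮ := by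
  let T₁ : Submodule ℝ T := T'.submoduleOf T
  let C := T₁ᗮ
  have hC : IsCompl T₁ C := Submodule.isCompl_orthogonal _
  let e := ((Module.finBasis ℝ T₁).prod (Module.finBasis ℝ C)).map
    (Submodule.prodEquivOfIsCompl T₁ C hC)
  refine ⟨_, _, e, ?_, ?_, fun i => ?_, fun i => ?_⟩
  · exact (Submodule.submoduleOfEquivOfLe h).finrank_eq
  · exact Submodule.finrank_add_eq_of_isCompl hC
  · have h1 : (e (Sum.inl i)) ∈ T₁ := by
      simp only [e, Module.Basis.map_apply, Submodule.coe_prodEquivOfIsCompl']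
      simp
    exact h1
  · have h1 : (e (Sum.inr i)) ∈ C := by
      simp only [e, Module.Basis.map_apply, Submodule.coe_prodEquivOfIsCompl']
      simp
    rw [Submodule.mem_orthogonal] at h1 ⊢
    intro u hu
    exact h1 ⟨u, h hu⟩ hu

/-- The algebraic heart of the induction. Evaluate on basis vectors of T, each in T' or normal to
T'. Vectors normal to T are also normal to T', so every tuple is of the type tested by some
component relative to T'; the number of its T' slots lies in the range allowed for `p`. -/
lemma theta_eq_zero_of_le {T' T : Submodule ℝ V} (h : T' ≤ T) {ℓ p : ℕ} {w : V [⋀^Fin ℓ]→ₗ[ℝ] ℝ}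
    (hw : ∀ q' ∈ jIdx ℓ (Module.finrank ℝ T') p, theta T' T'ᗮ ℓ q' w = 0) {q : ℕ}
    (hq : q ∈ jIdx ℓ (Module.finrank ℝ T) p) : theta T Tᗮ ℓ q w = 0 := by
  obtain ⟨hqℓ, hqm, hmq⟩ := mem_jIdx.1 hq
  obtain ⟨a, c, e, ha, hac, hl, hr⟩ := exists_adapted_basis h
  refine e.ext_alternating fun v hv => ?_
  ext z
  rw [theta_apply hqℓ]
  set y : Fin ℓ → V := fun i =>
    Sum.elim (T.subtype ∘ fun i => e (v i)) (Tᗮ.subtype ∘ z) (slotEquiv hqℓ i) with hy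
  -- `s₁` marks the tangential slots filled by vectors of T'; `s` is the same set of slots among all
  -- ℓ.
  let s₁ : Finset (Fin q) := Finset.univ.filter fun j => (v j).isLeft
  let s : Finset (Fin ℓ) := 
    s₁.map (Function.Embedding.inl.trans (slotEquiv hqℓ).symm.toEmbedding)
  have hs : s.card = s₁.card := Finset.card_map _
  have h1 : s₁.card ≤ a := by
    have : s₁.card ≤ (Finset.univ.map (Function.Embedding.inl : Fin a ↪ Fin a ⊕ Fin c)).card := by
      refine Finset.card_le_card_of_injOn v (fun j hj => ?_) hv.injOn
      have := (Finset.mem_filter.1 hj).2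
      obtain ⟨i, hi⟩ := Sum.isLeft_iff.1 this
      simp [hi]
    simpa using this
  have h2 : s₁ᶜ.card ≤ c := by
    have : s₁ᶜ.card ≤ (Finset.univ.map (Function.Embedding.inr : Fin c ↪ Fin a ⊕ Fin c)).card := by
      refine Finset.card_le_card_of_injOn v (fun j hj => ?_) hv.injOn
      have : ¬ (v j).isLeft := by simpa [s₁] using hj
      obtain ⟨i, hi⟩ := Sum.isRight_iff.1 (Sum.not_isLeft.1 this)
      simp [hi]
    simpa using this
  rw [Finset.card_compl, Fintype.card_fin] at h2
  have h3 : s₁.card ≤ q := by simpa using Finset.card_le_univ s₁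
  -- The remaining q - |s₁| tangential slots hold distinct basis vectors of a complement of
  -- dimension c, so q - |s₁| ≤ c; with a + c < q + p this gives a < |s₁| + p.
  have hq' : s₁.card ∈ jIdx ℓ (Module.finrank ℝ T') p := by
    rw [mem_jIdx]
    omega
  refine apply_eq_zero_of_theta (hw _ hq') y s hs (fun i hi => ?_) fun i hi => ?_
  · obtain ⟨j, hj, rfl⟩ := Finset.mem_map.1 hi
    obtain ⟨t, ht⟩ := Sum.isLeft_iff.1 (Finset.mem_filter.1 hj).2
    simpa [hy, ht] using hl t
  · rcases hi' : slotEquiv hqℓ i with j | j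
    · have : ¬ (v j).isLeft := fun hj => hi <| Finset.mem_map.2
        ⟨j, by simpa [s₁] using hj, by simp [← hi']⟩
      obtain ⟨t, ht⟩ := Sum.isRight_iff.1 (Sum.not_isLeft.1 this)
      simpa [hy, hi', ht] using hr t
    · simpa [hy, hi'] using Submodule.orthogonal_le h (z j).2

end InnerProduct

/-! ### Tangent spaces of simplices -/

section Tangent

variable {n : ℕ} {σ : Finset (Eucl n)}

lemma finrank_tang (h : AffineIndependent ℝ ((↑) : σ → Eucl n)) (hσ : σ.Nonempty) :
    Module.finrank ℝ (tang σ) = sdim σ := by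
  have hc : Fintype.card σ = sdim σ + 1 := by
    have := hσ.card_pos
    simp [sdim]
    omega
  have := h.finrank_vectorSpan hc
  rwa [Subtype.range_coe_subtype, Finset.setOfPred_mem] at this

lemma exists_edge_basis (h : AffineIndependent ℝ ((↑) : σ → Eucl n)) {v : Eucl n} (hv : v ∈ σ) :
    ∃ e : Module.Basis (σ.erase v) ℝ (tang σ), ∀ i, (e i : Eucl n) = i - v := by
  have hmem : ∀ i ∈ σ, i - v ∈ tang σ := fun i hi =>
    vsub_mem_vectorSpan ℝ (Finset.mem_coe.2 hi) (Finset.mem_coe.2 hv)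
  let f : σ.erase v → tang σ := fun i => ⟨i - v, hmem i (Finset.mem_of_mem_erase i.2)⟩
  have hf : LinearIndependent ℝ f := by
    have h1 := (affineIndependent_iff_linearIndependent_vsub ℝ _ (⟨v, hv⟩ : σ)).1 h
    refine LinearIndependent.of_comp (tang σ).subtype ?_
    let g : σ.erase v → {x : σ // x ≠ ⟨v, hv⟩} := fun i =>
      ⟨⟨i, Finset.mem_of_mem_erase i.2⟩,
        fun hi => Finset.ne_of_mem_erase i.2 (congrArg Subtype.val hi)⟩
    exact h1.comp g fun i j hij => by
      exact Subtype.ext (congrArg (fun x : {x : σ // x ≠ ⟨v, hv⟩} => (x.1 : Eucl n)) hij)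
  have hc : Fintype.card (σ.erase v) = Module.finrank ℝ (tang σ) := by
    rw [finrank_tang h ⟨v, hv⟩, Fintype.card_coe, Finset.card_erase_of_mem hv]
  by_cases hne : Nonempty (σ.erase v)
  · refine ⟨basisOfLinearIndependentOfCardEqFinrank hf hc, fun i => ?_⟩
    simp [f]
  -- A single vertex: there are no edges and the tangent space is zero.
  · rw [not_nonempty_iff] at hne
    have : Subsingleton (tang σ) := by
      rw [← Module.finrank_zero_iff (R := ℝ), ← hc, Fintype.card_of_isEmpty]
    exact ⟨Module.Basis.empty _, fun i => isEmptyElim i⟩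

end Tangent

/-! ### The Euclidean measure on a simplex -/

section Measure

variable {n : ℕ} {σ : Finset (Eucl n)}

/-- The simplex `hull σ` in the affine coordinates of its tangent space with origin `v`. -/
def flatHull (σ : Finset (Eucl n)) (v : Eucl n) : Set (tang σ) :=
  (fun y : tang σ => (y : Eucl n) + v) ⁻¹' hull σ

lemma isometry_tang_add (σ : Finset (Eucl n)) (v : Eucl n) :
    Isometry fun y : tang σ => (y : Eucl n) + v :=
  Isometry.of_dist_eq fun x y => by simp [Subtype.dist_eq]

lemma hull_subset_range {v : Eucl n} (hv : v ∈ σ) :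
    hull σ ⊆ Set.range fun y : tang σ => (y : Eucl n) + v := by
  intro x hx
  have h1 : x ∈ affineSpan ℝ (σ : Set (Eucl n)) := convexHull_subset_affineSpan _ hx
  have h2 : v ∈ affineSpan ℝ (σ : Set (Eucl n)) := subset_affineSpan ℝ _ (Finset.mem_coe.2 hv)
  have h3 := AffineSubspace.vsub_mem_direction h1 h2
  rw [direction_affineSpan] at h3
  exact ⟨⟨_, h3⟩, by simp⟩

lemma isCompact_flatHull (σ : Finset (Eucl n)) (v : Eucl n) : IsCompact (flatHull σ v) := by
  have hc : IsCompact (hull σ) := σ.finite_toSet.isCompact_convexHull ℝ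
  refine (isometry_tang_add σ v).isClosedEmbedding.isCompact_preimage hc

lemma convex_flatHull (σ : Finset (Eucl n)) (v : Eucl n) : Convex ℝ (flatHull σ v) := by
  have : flatHull σ v = (tang σ).subtype ⁻¹' ((fun x => x + v) ⁻¹' hull σ) := rfl
  rw [this]
  exact ((convex_convexHull ℝ _).translate_preimage_left v).linear_preimage _

lemma interior_flatHull_nonempty (h : AffineIndependent ℝ ((↑) : σ → Eucl n)) {v : Eucl n}
    (hv : v ∈ σ) : (interior (flatHull σ v)).Nonempty := by
  rw [(convex_flatHull σ v).interior_nonempty_iff_affineSpan_eq_top]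
  obtain ⟨e, he⟩ := exists_edge_basis h hv
  have h0 : (0 : tang σ) ∈ flatHull σ v := by
    simpa [flatHull] using subset_convexHull ℝ _ (Finset.mem_coe.2 hv)
  have h1 : ∀ i, e i ∈ flatHull σ v := fun i => by
    simpa [flatHull, he] using
      subset_convexHull ℝ _ (Finset.mem_coe.2 (Finset.mem_of_mem_erase i.2))
  rw [AffineSubspace.affineSpan_eq_top_iff_vectorSpan_eq_top_of_nonempty ℝ _ _ ⟨0, h0⟩, eq_top_iff,
    ← e.span_eq, Submodule.span_le]
  rintro _ ⟨i, rfl⟩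
  simpa using vsub_mem_vectorSpan ℝ (h1 i) h0

/-- Translation by a vertex is an isometry from the tangent space onto the affine span. It turns the
measure on the simplex into a measure of full dimension, where compact sets have finite mass and
nonempty open sets positive mass. -/
lemma measure_hull_eq {v : Eucl n} (hv : v ∈ σ) (m : ℕ) (U : Set (hull σ)) :
    (μHE[m] : Measure (hull σ)) U =
      (μHE[m] : Measure (tang σ)) ((fun y : tang σ => (y : Eucl n) + v) ⁻¹' (Subtype.val '' U)) := by
  rw [← isometry_subtype_coe.euclideanHausdorffMeasure_image,
    ← (isometry_tang_add σ v).euclideanHausdorffMeasure_image, Set.image_preimage_eq_of_subset]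
  exact fun x ⟨y, _, hy⟩ => hull_subset_range hv (hy ▸ y.2)

lemma isFiniteMeasure_hull (h : AffineIndependent ℝ ((↑) : σ → Eucl n)) (hσ : σ.Nonempty) :
    IsFiniteMeasure (μHE[sdim σ] : Measure (hull σ)) := by
  obtain ⟨v, hv⟩ := hσ
  constructor
  rw [measure_hull_eq hv, ← finrank_tang h ⟨v, hv⟩]
  rw [Set.image_univ, Subtype.range_coe]
  exact (isCompact_flatHull σ v).measure_lt_top

lemma isOpenPosMeasure_hull (h : AffineIndependent ℝ ((↑) : σ → Eucl n)) (hσ : σ.Nonempty) :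
    (μHE[sdim σ] : Measure (hull σ)).IsOpenPosMeasure := by
  obtain ⟨v, hv⟩ := hσ
  constructor
  rintro U hU ⟨x, hx⟩
  obtain ⟨O, hO, rfl⟩ := isOpen_induced_iff.1 hU
  rw [measure_hull_eq hv, ← finrank_tang h ⟨v, hv⟩, Subtype.image_preimage_coe, Set.preimage_inter]
  set φ := fun y : tang σ => (y : Eucl n) + v with hφ
  obtain ⟨y, hy⟩ := hull_subset_range hv x.2
  have hφc : Continuous φ := (isometry_tang_add σ v).continuous
  -- The point may lie on the boundary. A convex set with nonempty interior lies in the closure of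
  -- that interior, so every neighbourhood of the point meets the interior.
  have hy1 : y ∈ closure (interior (flatHull σ v)) := by
    rw [(convex_flatHull σ v).closure_interior_eq_closure_of_nonempty_interior
      (interior_flatHull_nonempty h hv)]
    refine subset_closure ?_
    change φ y ∈ hull σ
    rw [hφ, hy]
    exact x.2
  have hO' : IsOpen (φ ⁻¹' O) := hO.preimage hφc
  have hy2 : y ∈ φ ⁻¹' O := by
    change φ y ∈ O
    rw [hφ, hy]
    exact hx
  obtain ⟨z, hz1, hz2⟩ := mem_closure_iff.1 hy1 _ hO' hy2
  have hpos : 0 < (μHE[Module.finrank ℝ (tang σ)] : Measure (tang σ))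
      (φ ⁻¹' O ∩ interior (flatHull σ v)) :=
    (hO'.inter isOpen_interior).measure_pos _ ⟨z, hz1, hz2⟩
  refine (hpos.trans_le (measure_mono ?_)).ne'
  rintro z ⟨h1, h2⟩
  exact ⟨interior_subset h2, h1⟩

end Measure

/-! ### Pairings defined by finitely many functionals -/

section Pairing

variable {n r r' : ℕ} {σ : Finset (Eucl n)} {W ι : Type*} [AddCommGroup W] [Module ℝ W] [Fintype ι]

/-- The integral over `σ` of the product of the values of a finite family of functionals. -/
def pairing (σ : Finset (Eucl n)) (φ : ι → W →ₗ[ℝ] ℝ) (η b : hull σ → W) : ℝ :=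
  ∫ x, ∑ i, φ i (η x) * φ i (b x) ∂(μHE[sdim σ] : Measure (hull σ))

variable {φ : ι → W →ₗ[ℝ] ℝ}

lemma pairing_comm (η b : hull σ → W) : pairing σ φ η b = pairing σ φ b η := by
  simp only [pairing, mul_comm]

lemma compactSpace_hull : CompactSpace (hull σ) :=
  isCompact_iff_compactSpace.1 (σ.finite_toSet.isCompact_convexHull ℝ)

lemma continuous_integrand {η b : hull σ → W} (hη : η ∈ polyMap (hull σ) r W)
    (hb : b ∈ polyMap (hull σ) r' W) : Continuous fun x => ∑ i, φ i (η x) * φ i (b x) :=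
  continuous_finsetSum _ fun i _ =>
    (continuous_of_mem_polyMap (φ i) hη).mul (continuous_of_mem_polyMap (φ i) hb)

lemma integrable_of_continuous (h : AffineIndependent ℝ ((↑) : σ → Eucl n)) (hσ : σ.Nonempty)
    {f : hull σ → ℝ} (hf : Continuous f) : Integrable f (μHE[sdim σ] : Measure (hull σ)) := by
  have := isFiniteMeasure_hull h hσ
  have := compactSpace_hull (σ := σ)
  exact hf.integrable_of_hasCompactSupport (HasCompactSupport.of_compactSpace f)

lemma pairing_add_left (h : AffineIndependent ℝ ((↑) : σ → Eucl n)) (hσ : σ.Nonempty)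
    {η η' b : hull σ → W} (hη : η ∈ polyMap (hull σ) r W) (hη' : η' ∈ polyMap (hull σ) r W)
    (hb : b ∈ polyMap (hull σ) r' W) :
    pairing σ φ (η + η') b = pairing σ φ η b + pairing σ φ η' b := by
  rw [pairing, pairing, pairing, ← integral_add
    (integrable_of_continuous h hσ (continuous_integrand hη hb))
    (integrable_of_continuous h hσ (continuous_integrand hη' hb))]
  simp [add_mul, Finset.sum_add_distrib]

lemma pairing_smul_left (c : ℝ) (η b : hull σ → W) :
    pairing σ φ (c • η) b = c * pairing σ φ η b := by
  rw [pairing, pairing, ← integral_const_mul]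
  simp [Finset.mul_sum, mul_assoc]

/-- The integrand is a continuous sum of squares with integral zero against a measure positive on
open sets, so it vanishes everywhere; the functionals separate values. -/
lemma eq_zero_of_pairing_self (h : AffineIndependent ℝ ((↑) : σ → Eucl n)) (hσ : σ.Nonempty)
    (hφ : ∀ w, (∀ i, φ i w = 0) → w = 0) {η : hull σ → W} (hη : η ∈ polyMap (hull σ) r W)
    (h0 : pairing σ φ η η = 0) : η = 0 := by
  have := isOpenPosMeasure_hull h hσ
  have hc : Continuous fun x => ∑ i, φ i (η x) * φ i (η x) := continuous_integrand hη hη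
  have hnn : 0 ≤ fun x => ∑ i, φ i (η x) * φ i (η x) := fun x =>
    Finset.sum_nonneg fun i _ => mul_self_nonneg _
  rw [pairing, integral_eq_zero_iff_of_nonneg hnn (integrable_of_continuous h hσ hc)] at h0
  have h1 := (hc.ae_eq_iff_eq _ continuous_const).1 h0
  funext x
  refine hφ _ fun i => ?_
  have h2 : ∑ i, φ i (η x) * φ i (η x) = 0 := congrFun h1 x
  exact mul_self_eq_zero.1
    ((Finset.sum_eq_zero_iff_of_nonneg fun i _ => mul_self_nonneg _).1 h2 i (Finset.mem_univ i))

end Pairing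

/-! ### The inner products as pairings -/

section AltInner

variable {V W : Type*} [NormedAddCommGroup V] [InnerProductSpace ℝ V] [FiniteDimensional ℝ V]
  [AddCommGroup W] [Module ℝ W] {k : ℕ}

/-- Evaluation at the basis multivector with index `I`, followed by a functional of the value. -/
def altFun {ι : Type*} (φ : ι → W →ₗ[ℝ] ℝ) (i : (Fin k ↪o Fin (Module.finrank ℝ V)) × ι) :
    (V [⋀^Fin k]→ₗ[ℝ] W) →ₗ[ℝ] ℝ where
  toFun α := φ i.2 (α (stdOrthonormalBasis ℝ V ∘ i.1))
  map_add' _ _ := by simp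
  map_smul' _ _ := by simp

/-- If the form on the values is a sum of products of functionals, so is the induced form on
alternating maps. Iterating from multiplication on ℝ brings both inner products into the shape
required by `pairing`. -/
lemma altInner_eq_sum {ι : Type*} [Fintype ι] {B : W → W → ℝ} {φ : ι → W →ₗ[ℝ] ℝ}
    (hB : ∀ a b, B a b = ∑ i, φ i a * φ i b) (α β : V [⋀^Fin k]→ₗ[ℝ] W) :
    altInner B α β = ∑ i, altFun φ i α * altFun φ i β := by
  simp only [altInner, hB, altFun, Fintype.sum_prod_type, LinearMap.coe_mk, AddHom.coe_mk]

lemma altFun_separating {ι : Type*} {φ : ι → W →ₗ[ℝ] ℝ} (hφ : ∀ w, (∀ i, φ i w = 0) → w = 0)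
    (α : V [⋀^Fin k]→ₗ[ℝ] W) (h : ∀ i, altFun φ i α = 0) : α = 0 := by
  refine alternatingMap_eq_zero (stdOrthonormalBasis ℝ V).toBasis α fun I hI =>
    ⟨I.orderEmbOfFin hI, (I.orderEmbOfFin hI).injective, by simp, hφ _ fun i => ?_⟩
  have := h (I.orderEmbOfFin hI, i)
  simpa [altFun, Function.comp_def] using this

/-- The functional with which the product of real numbers is a pairing. -/
def idFun (_ : Unit) : ℝ →ₗ[ℝ] ℝ := LinearMap.id

lemma mul_eq_sum (a b : ℝ) : a * b = ∑ i, idFun i a * idFun i b := by simp [idFun]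

lemma idFun_separating (w : ℝ) (h : ∀ i, idFun i w = 0) : w = 0 := h ()

variable {n ℓ q q' : ℕ}

lemma pair₂_eq (σ : Finset (Eucl n)) (η b : hull σ → AltAlt k ℓ (tang σ)) :
    pair₂ σ η b = pairing σ (altFun (altFun idFun)) η b := by
  simp only [pair₂, pairing, altInner_eq_sum (altInner_eq_sum mul_eq_sum)]

set_option maxSynthPendingDepth 6 in
lemma pair₃_eq (σ : Finset (Eucl n)) (η b : hull σ → tang σ [⋀^Fin k]→ₗ[ℝ] TanNor q q' σ) :
    pair₃ σ η b = pairing (W := tang σ [⋀^Fin k]→ₗ[ℝ] TanNor q q' σ) σ (altFun (altFun (altFun idFun))) η b := by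
  simp only [pair₃, pairing, altInner_eq_sum (altInner_eq_sum (altInner_eq_sum mul_eq_sum))]

end AltInner

/-! ### Dimension bounds for the bubble spaces -/

section Apply

variable {V V' W : Type*} [AddCommGroup V] [Module ℝ V] [AddCommGroup V'] [Module ℝ V']
  [AddCommGroup W] [Module ℝ W]

lemma pull_apply {k : ℕ} (g : V' →ₗ[ℝ] V) (f : V [⋀^Fin k]→ₗ[ℝ] W) (u : Fin k → V') :
    pull k W g f u = f fun i => g (u i) := rfl

/-- Evaluation of alternating maps at a tuple. -/
def evalAt {k : ℕ} (u : Fin k → V) : (V [⋀^Fin k]→ₗ[ℝ] W) →ₗ[ℝ] W where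
  toFun f := f u
  map_add' _ _ := rfl
  map_smul' _ _ := rfl

/-- Pullback of `(k,ℓ)`-forms in both indices. -/
def doublePull (k ℓ : ℕ) (g : V' →ₗ[ℝ] V) : AltAlt k ℓ V →ₗ[ℝ] AltAlt k ℓ V' :=
  pullMap k g (pull ℓ ℝ g)

lemma doublePull_apply {k ℓ : ℕ} (g : V' →ₗ[ℝ] V) (f : AltAlt k ℓ V) (u : Fin k → V')
    (z : Fin ℓ → V') : doublePull k ℓ g f u z = f (fun i => g (u i)) fun i => g (z i) := rfl

lemma iotaFace_apply {n k : ℕ} {F σ : Finset (Eucl n)} (h : F ⊆ σ)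
    (b : hull σ → tang σ [⋀^Fin k]→ₗ[ℝ] W) (x : hull F) (u : Fin k → tang F) :
    iotaFace k W h b x u = b (Set.inclusion (hull_mono h) x)
      fun i => Submodule.inclusion (tang_mono h) (u i) := rfl

end Apply

/-! ### Edge vectors issuing from a vertex -/

section Edges

variable {n k : ℕ} {σ F I : Finset (Eucl n)} {v x : Eucl n} {W : Type*} [AddCommGroup W] [Module ℝ W]

/-- An enumeration of a set of `k` points. -/
def enum (k : ℕ) (I : Finset (Eucl n)) : Fin k → Eucl n :=
  if h : I.card = k then fun i => (I.equivFinOfCardEq h).symm i else 0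

lemma enum_mem (h : I.card = k) (i : Fin k) : enum k I i ∈ I := by
  rw [enum, dif_pos h]
  exact ((I.equivFinOfCardEq h).symm i).2

lemma enum_injective (h : I.card = k) : Function.Injective (enum k I) := by
  rw [enum, dif_pos h]
  exact Subtype.val_injective.comp (I.equivFinOfCardEq h).symm.injective

/-- The edge vector from `v` to `x`, as a tangent vector of `σ`. -/
def edge (σ : Finset (Eucl n)) (v x : Eucl n) : tang σ :=
  if h : x - v ∈ tang σ then ⟨x - v, h⟩ else 0

lemma coe_edge (hv : v ∈ σ) (hx : x ∈ σ) : (edge σ v x : Eucl n) = x - v := by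
  rw [edge, dif_pos]
  exact vsub_mem_vectorSpan ℝ (Finset.mem_coe.2 hx) (Finset.mem_coe.2 hv)

lemma inclusion_edge (h : F ⊆ σ) (hv : v ∈ F) (hx : x ∈ F) :
    Submodule.inclusion (tang_mono h) (edge F v x) = edge σ v x := by
  ext1
  rw [Submodule.coe_inclusion, coe_edge hv hx, coe_edge (h hv) (h hx)]

/-- The edges from one vertex form a basis of the tangent space, and an edge whose endpoints lie in
a face is tangent to that face; this makes the values on edges suited to bubble conditions. -/
lemma eq_zero_of_edges (h : AffineIndependent ℝ ((↑) : σ → Eucl n)) (hv : v ∈ σ)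
    (w : tang σ [⋀^Fin k]→ₗ[ℝ] W)
    (hw : ∀ I ∈ (σ.erase v).powersetCard k, w (fun i => edge σ v (enum k I i)) = 0) : w = 0 := by
  obtain ⟨e, he⟩ := exists_edge_basis h hv
  refine alternatingMap_eq_zero e w fun I hI => ?_
  set I' : Finset (Eucl n) := I.map (Function.Embedding.subtype _) with hI'
  have hc : I'.card = k := by rw [hI', Finset.card_map, hI]
  have hsub : I' ⊆ σ.erase v := by
    intro x hx
    obtain ⟨y, -, rfl⟩ := Finset.mem_map.1 hx
    exact y.2
  let j : Fin k → σ.erase v := fun i => ⟨enum k I' i, hsub (enum_mem hc i)⟩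
  have hj : Function.Injective j := fun a b hab => enum_injective hc (congrArg Subtype.val hab)
  have hmem : ∀ i, j i ∈ I := fun i => by
    have := enum_mem hc i
    rw [hI', Finset.mem_map] at this
    obtain ⟨y, hy, hy'⟩ := this
    have : y = j i := Subtype.ext hy'
    exact this ▸ hy
  refine ⟨j, hj, ?_, ?_⟩
  · have h1 : Finset.univ.image j ⊆ I := fun x hx => by
      obtain ⟨i, -, rfl⟩ := Finset.mem_image.1 hx
      exact hmem i
    have h2 : Finset.univ.image j = I := Finset.eq_of_subset_of_card_le h1 (by
      rw [Finset.card_image_of_injective _ hj, hI, Finset.card_univ, Fintype.card_fin])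
    rw [← h2]
    simp
  · rw [← hw I' (Finset.mem_powersetCard.2 ⟨hsub, hc⟩)]
    congr 1
    funext i
    ext1
    rw [he, coe_edge hv (Finset.mem_of_mem_erase (hsub (enum_mem hc i)))]

end Edges

/-! ### Barycentric coefficients of bubbles -/

section Coefficients

variable {n r k ℓ : ℕ} {σ F : Finset (Eucl n)} {lam : Eucl n → Eucl n →ᵃ[ℝ] ℝ}
  {W' W : Type*} [AddCommGroup W'] [Module ℝ W'] [AddCommGroup W] [Module ℝ W]

/-- If a linear image of a polynomial vanishes on a face, then so do the images of the coefficients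
of the monomials supported in this face. -/
lemma coeff_eq_zero_of_face (h : IsBary σ lam) (hF : F ⊆ σ) (hne : F.Nonempty)
    (c : expo σ r → W) (A : W →ₗ[ℝ] W')
    (h0 : ∀ (x : Eucl n) (hx : x ∈ hull F), A (synth lam σ r W c ⟨x, hull_mono hF hx⟩) = 0)
    (α : expo σ r) (hα : (α : Eucl n →₀ ℕ).support ⊆ F) : A (c α) = 0 := by
  let c' : (Eucl n →₀ ℕ) → W' := fun α => if h : α ∈ expo σ r then A (c ⟨α, h⟩) else 0
  have hc' : ∀ α : expo σ r, c' α = A (c α) := fun α => dif_pos α.2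
  rw [← hc' α]
  refine eq_zero_of_sum_mono_eq_zero (r := r) (h.mono hF) hne (fun x hx => ?_) α
    (mem_expo_of_support α.2 hα)
  have h1 := h0 x hx
  simp only [synth_apply, map_sum, map_smul, ← hc'] at h1
  rw [Finset.sum_coe_sort (expo σ r) fun α => mono lam α x • c' α] at h1
  rw [← h1]
  -- On F the monomials not supported in F vanish; the others are linearly independent there.
  refine Finset.sum_subset (expo_mono hF) fun β hβ hβF => ?_
  rw [mono_eq_zero h hF hx hβ fun hs => hβF (mem_expo_of_support hβ hs), zero_smul]

lemma finrank_le_of_coeff [Module.Finite ℝ W'] (h : IsBary σ lam)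
    (X : Submodule ℝ (hull σ → W)) (hX : X ≤ polyMap (hull σ) r W)
    (T : (expo σ r → W) →ₗ[ℝ] W')
    (hT : ∀ c, synth lam σ r W c ∈ X → T c = 0 → c = 0) :
    Module.Finite ℝ X ∧ Module.finrank ℝ X ≤ Module.finrank ℝ W' := by
  by_cases hσ : σ.Nonempty
  · let E := (synthEquiv h hσ r W).symm
    let f : X →ₗ[ℝ] W' := T ∘ₗ E.toLinearMap ∘ₗ Submodule.inclusion hX
    have hf : Function.Injective f := by
      rw [← LinearMap.ker_eq_bot, LinearMap.ker_eq_bot']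
      intro b hb
      have h1 : synth lam σ r W (E (Submodule.inclusion hX b)) = b.1 :=
        congrArg Subtype.val ((synthEquiv h hσ r W).apply_symm_apply (Submodule.inclusion hX b))
      have h2 := hT (E (Submodule.inclusion hX b)) (h1 ▸ b.2) hb
      rw [h2, map_zero] at h1
      exact Subtype.ext h1.symm
    exact ⟨Module.Finite.of_injective f hf, LinearMap.finrank_le_finrank_of_injective hf⟩
  · rw [Finset.not_nonempty_iff_eq_empty] at hσ
    subst hσ
    have : IsEmpty (hull (∅ : Finset (Eucl n))) := by simp
    have h1 : Subsingleton X := inferInstance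
    exact ⟨inferInstance, by rw [Module.finrank_zero_of_subsingleton]; exact Nat.zero_le _⟩

/-- A vertex in the support of an exponent. -/
def pick (α : Eucl n →₀ ℕ) : Eucl n := if h : α.support.Nonempty then h.choose else 0

/-- This is where r ≥ 1 enters: for r = 0 the only exponent has empty support. -/
lemma pick_mem (hr : 1 ≤ r) {α : Eucl n →₀ ℕ} (hα : α ∈ expo σ r) : pick α ∈ α.support := by
  have h : α.support.Nonempty := by
    rw [Finset.nonempty_iff_ne_empty]
    intro h0
    have := (Finset.mem_finsuppAntidiag'.1 hα).1
    rw [Finsupp.support_eq_empty.1 h0, Finsupp.sum_zero_index] at this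
    omega
  rw [pick, dif_pos h]
  exact h.choose_spec

lemma support_subset {α : Eucl n →₀ ℕ} (hα : α ∈ expo σ r) : α.support ⊆ σ :=
  (Finset.mem_finsuppAntidiag'.1 hα).2

/-- The indices `(α, I)` of the basis of barycentric `k`-forms of degree `r` on `σ`. -/
def formIdx (r k : ℕ) (σ : Finset (Eucl n)) : Finset (Σ _ : Eucl n →₀ ℕ, Finset (Eucl n)) :=
  (expo σ r).sigma fun α => (σ.erase (pick α)).powersetCard k

/-- The indices `(α, I, J)` of the basis of barycentric `(k,ℓ)`-forms of degree `r` on `σ`. -/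
def formIdx₂ (r k ℓ : ℕ) (σ : Finset (Eucl n)) :
    Finset (Σ _ : Eucl n →₀ ℕ, Finset (Eucl n) × Finset (Eucl n)) :=
  (expo σ r).sigma fun α =>
    (σ.erase (pick α)).powersetCard k ×ˢ (σ.erase (pick α)).powersetCard ℓ

/-- The indices of the basis of the bubbles on `σ`. -/
def bubbleIdx (r k : ℕ) (σ : Finset (Eucl n)) : Finset (Σ _ : Eucl n →₀ ℕ, Finset (Eucl n)) :=
  (formIdx r k σ).filter fun x => x.1.support ∪ x.2 = σ

/-- The indices of the basis of the bubbles of the double trace on `σ`. -/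
def bubbleIdx₂ (r k ℓ : ℕ) (σ : Finset (Eucl n)) :
    Finset (Σ _ : Eucl n →₀ ℕ, Finset (Eucl n) × Finset (Eucl n)) :=
  (formIdx₂ r k ℓ σ).filter fun x => x.1.support ∪ x.2.1 ∪ x.2.2 = σ

lemma iotaFace_eq_zero_of_mem_bubbleTensor {b : hull σ → tang σ [⋀^Fin k]→ₗ[ℝ] W}
    (hb : b ∈ bubbleTensor r k σ W) (hF : F ⊂ σ) (hne : F.Nonempty) :
    iotaFace k W hF.subset b = 0 := by
  suffices bubbleTensor r k σ W ≤ LinearMap.ker (iotaFace k W hF.subset) from this hb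
  refine Submodule.span_le.2 ?_
  rintro _ ⟨b, hb, w, rfl⟩
  refine LinearMap.mem_ker.2 ?_
  funext x
  ext u
  have h0 := congrArg (fun f => f u) (congrFun (hb.2 F hF hne) x)
  simp only [iotaFace_apply, Pi.zero_apply, AlternatingMap.zero_apply] at h0
  rw [iotaFace_apply, LinearMap.compAlternatingMap_apply, h0, map_zero, Pi.zero_apply,
    AlternatingMap.zero_apply]

/-- Composition with a linear map of the values. -/
def mapValue (k : ℕ) {V : Type*} [AddCommGroup V] [Module ℝ V] (A : W →ₗ[ℝ] W') :
    (V [⋀^Fin k]→ₗ[ℝ] W) →ₗ[ℝ] (V [⋀^Fin k]→ₗ[ℝ] W') where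
  toFun f := A.compAlternatingMap f
  map_add' _ _ := by ext; simp
  map_smul' _ _ := by ext; simp

lemma bubbleTensor_le_polyMap :
    bubbleTensor r k σ W ≤ polyMap (hull σ) r (tang σ [⋀^Fin k]→ₗ[ℝ] W) := by
  refine Submodule.span_le.2 ?_
  rintro _ ⟨b, hb, w, rfl⟩
  exact polyMap_linear_comp (mapValue k (LinearMap.toSpanSingleton ℝ W w)) hb.1

/-- For finite-dimensional W, bubbles with constant coefficients in W are exactly the W-valued
polynomial forms with zero trace on the boundary: take coordinates in a basis of W. -/
lemma mem_bubbleTensor [Module.Finite ℝ W] {b : hull σ → tang σ [⋀^Fin k]→ₗ[ℝ] W}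
    (hb : b ∈ polyMap (hull σ) r (tang σ [⋀^Fin k]→ₗ[ℝ] W))
    (h0 : ∀ (F : Finset (Eucl n)) (hF : F ⊂ σ), F.Nonempty → iotaFace k W hF.subset b = 0) :
    b ∈ bubbleTensor r k σ W := by
  let e := Module.finBasis ℝ W
  have hsum : b = ∑ i, fun x => (LinearMap.toSpanSingleton ℝ W (e i)).compAlternatingMap
      ((e.coord i).compAlternatingMap (b x)) := by
    funext x
    ext u
    have h1 := e.sum_repr (b x u)
    rw [Finset.sum_apply]
    change _ = evalAt u _
    rw [map_sum]
    exact h1.symm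
  rw [hsum]
  refine Submodule.sum_mem _ fun i _ => Submodule.subset_span ⟨_, ⟨?_, fun F hF hne => ?_⟩, e i, rfl⟩
  · exact polyMap_linear_comp (mapValue k (e.coord i)) hb
  · funext x
    ext u
    have h1 := congrArg (fun f => f u) (congrFun (h0 F hF hne) x)
    simp only [iotaFace_apply, Pi.zero_apply, AlternatingMap.zero_apply] at h1
    rw [iotaFace_apply, LinearMap.compAlternatingMap_apply, h1, map_zero, Pi.zero_apply,
      AlternatingMap.zero_apply]

lemma fst_mem_expo (x : bubbleIdx r k σ) : x.1.1 ∈ expo σ r :=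
  (Finset.mem_sigma.1 (Finset.mem_filter.1 x.2).1).1

lemma fst_mem_expo₂ (x : bubbleIdx₂ r k ℓ σ) : x.1.1 ∈ expo σ r :=
  (Finset.mem_sigma.1 (Finset.mem_filter.1 x.2).1).1

/-- A bubble is determined by the values of its coefficients c_α on the edge sets I from `pick α`
with supp α ∪ I = σ. All other values are zero by the trace condition on the face supp α ∪ I. -/
lemma finrank_bubbleTensor_le [Module.Finite ℝ W] (hr : 1 ≤ r) (h : IsBary σ lam)
    (hi : AffineIndependent ℝ ((↑) : σ → Eucl n)) :
    Module.Finite ℝ (bubbleTensor r k σ W) ∧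
      Module.finrank ℝ (bubbleTensor r k σ W) ≤ (bubbleIdx r k σ).card * Module.finrank ℝ W := by
  let T : (expo σ r → tang σ [⋀^Fin k]→ₗ[ℝ] W) →ₗ[ℝ] (bubbleIdx r k σ → W) :=
    { toFun := fun c x =>
        c ⟨x.1.1, fst_mem_expo x⟩ (fun i => edge σ (pick x.1.1) (enum k x.1.2 i))
      map_add' := fun _ _ => rfl
      map_smul' := fun _ _ => rfl }
  have key := finrank_le_of_coeff h (bubbleTensor r k σ W) bubbleTensor_le_polyMap T ?_
  · simpa [Module.finrank_pi_fintype] using key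
  intro c hc hT
  funext α
  have hv := pick_mem hr α.2
  refine eq_zero_of_edges hi (support_subset α.2 hv) _ fun I hI => ?_
  obtain ⟨hI1, hI2⟩ := Finset.mem_powersetCard.1 hI
  by_cases hu : (α : Eucl n →₀ ℕ).support ∪ I = σ
  · exact congrFun hT ⟨⟨α, I⟩, Finset.mem_filter.2 ⟨Finset.mem_sigma.2 ⟨α.2, hI⟩, hu⟩⟩
  -- F contains the support of α, so c_α survives restriction to F; it also contains `pick α` and I,
  -- so the edges in question are tangent to F.
  · set F := (α : Eucl n →₀ ℕ).support ∪ I with hF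
    have hFσ : F ⊂ σ := lt_of_le_of_ne
      (Finset.union_subset (support_subset α.2) (hI1.trans (Finset.erase_subset _ _))) hu
    have hvF : pick (α : Eucl n →₀ ℕ) ∈ F := Finset.mem_union_left _ hv
    have h0 := iotaFace_eq_zero_of_mem_bubbleTensor hc hFσ ⟨_, hvF⟩
    have h1 := coeff_eq_zero_of_face h hFσ.subset ⟨_, hvF⟩ c
      (pull k W (Submodule.inclusion (tang_mono hFσ.subset)))
      (fun x hx => congrFun h0 ⟨x, hx⟩) α Finset.subset_union_left
    have h2 := congrArg (fun f => f fun i => edge F (pick (α : Eucl n →₀ ℕ)) (enum k I i)) h1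
    simpa only [pull_apply,
      AlternatingMap.zero_apply, inclusion_edge hFσ.subset hvF
        (Finset.mem_union_right _ (enum_mem hI2 _))] using h2

lemma doublePull_eq_zero_of_mem_bubble₂ {b : hull σ → AltAlt k ℓ (tang σ)}
    (hb : b ∈ bubble₂ r k ℓ σ) (hF : F ⊂ σ) (hne : F.Nonempty) (x : Eucl n) (hx : x ∈ hull F) :
    doublePull k ℓ (Submodule.inclusion (tang_mono hF.subset))
      (b ⟨x, hull_mono hF.subset hx⟩) = 0 :=
  congrFun (hb.2 F hF hne) ⟨x, hx⟩

lemma coeff_edges_eq_zero (h : IsBary σ lam) {c : expo σ r → AltAlt k ℓ (tang σ)}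
    (hc : synth lam σ r (AltAlt k ℓ (tang σ)) c ∈ bubble₂ r k ℓ σ) (hF : F ⊂ σ) (hne : F.Nonempty)
    (α : expo σ r) (hα : (α : Eucl n →₀ ℕ).support ⊆ F) {v : Eucl n} (hv : v ∈ F)
    {u : Fin k → Eucl n} {z : Fin ℓ → Eucl n} (hu : ∀ i, u i ∈ F) (hz : ∀ i, z i ∈ F) :
    c α (fun i => edge σ v (u i)) (fun i => edge σ v (z i)) = 0 := by
  have := coeff_eq_zero_of_face h hF.subset hne c
    ((evalAt fun i => edge σ v (z i)).comp (evalAt fun i => edge σ v (u i))) (fun x hx => ?_) α hα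
  · exact this
  · have h0 := congrArg (fun f => f (fun i => edge F v (u i)) fun i => edge F v (z i))
      (doublePull_eq_zero_of_mem_bubble₂ hc hF hne x hx)
    simp only [doublePull_apply, AlternatingMap.zero_apply, inclusion_edge hF.subset hv (hu _),
      inclusion_edge hF.subset hv (hz _)] at h0
    exact h0

/-- As for `finrank_bubbleTensor_le`, with edge sets I and J for the two form indices and the face
supp α ∪ I ∪ J. -/
lemma finrank_bubble₂_le (hr : 1 ≤ r) (h : IsBary σ lam)
    (hi : AffineIndependent ℝ ((↑) : σ → Eucl n)) :
    Module.Finite ℝ (bubble₂ r k ℓ σ) ∧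
      Module.finrank ℝ (bubble₂ r k ℓ σ) ≤ (bubbleIdx₂ r k ℓ σ).card := by
  let T : (expo σ r → AltAlt k ℓ (tang σ)) →ₗ[ℝ] (bubbleIdx₂ r k ℓ σ → ℝ) :=
    { toFun := fun c x =>
        c ⟨x.1.1, fst_mem_expo₂ x⟩ (fun i => edge σ (pick x.1.1) (enum k x.1.2.1 i))
          (fun i => edge σ (pick x.1.1) (enum ℓ x.1.2.2 i))
      map_add' := fun _ _ => rfl
      map_smul' := fun _ _ => rfl }
  have key := finrank_le_of_coeff h (bubble₂ r k ℓ σ) (fun b (hb : b ∈ bubble₂ r k ℓ σ) => And.left hb) T ?_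
  · simpa using key
  intro c hc hT
  funext α
  have hv := pick_mem hr α.2
  refine eq_zero_of_edges hi (support_subset α.2 hv) _ fun I hI => ?_
  refine eq_zero_of_edges hi (support_subset α.2 hv) _ fun J hJ => ?_
  obtain ⟨hI1, hI2⟩ := Finset.mem_powersetCard.1 hI
  obtain ⟨hJ1, hJ2⟩ := Finset.mem_powersetCard.1 hJ
  by_cases hu : (α : Eucl n →₀ ℕ).support ∪ I ∪ J = σ
  · exact congrFun hT ⟨⟨α, I, J⟩,
      Finset.mem_filter.2 ⟨Finset.mem_sigma.2 ⟨α.2, Finset.mk_mem_product hI hJ⟩, hu⟩⟩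
  · set F := (α : Eucl n →₀ ℕ).support ∪ I ∪ J with hF
    have hFσ : F ⊂ σ := lt_of_le_of_ne
      (Finset.union_subset (Finset.union_subset (support_subset α.2)
        (hI1.trans (Finset.erase_subset _ _))) (hJ1.trans (Finset.erase_subset _ _))) hu
    have hsF : (α : Eucl n →₀ ℕ).support ⊆ F :=
      Finset.subset_union_left.trans Finset.subset_union_left
    have hIF : I ⊆ F := Finset.subset_union_right.trans Finset.subset_union_left
    have hJF : J ⊆ F := Finset.subset_union_right
    exact coeff_edges_eq_zero h hc hFσ ⟨_, hsF hv⟩ α hsF (hsF hv)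
      (fun i => hIF (enum_mem hI2 i)) fun i => hJF (enum_mem hJ2 i)

end Coefficients

/-! ### Counting -/

section Counting

variable {n r k ℓ p : ℕ} {K σ S : Finset (Eucl n)}

lemma finrank_polyMap {lam : Eucl n → Eucl n →ᵃ[ℝ] ℝ} (h : IsBary σ lam) (hσ : σ.Nonempty)
    {W : Type*} [AddCommGroup W] [Module ℝ W] [Module.Finite ℝ W] :
    Module.Finite ℝ (polyMap (hull σ) r W) ∧
      Module.finrank ℝ (polyMap (hull σ) r W) = (expo σ r).card * Module.finrank ℝ W := by
  refine ⟨Module.Finite.equiv (synthEquiv h hσ r W), ?_⟩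
  rw [← (synthEquiv h hσ r W).finrank_eq, Module.finrank_pi_fintype]
  simp

/-- The dimension of the space of values tested on `σ`. -/
def jDim (n ℓ p m : ℕ) : ℕ := ∑ q ∈ jIdx ℓ m p, m.choose q * (n - m).choose (ℓ - q)

/-- A q-subset of S without v and an (ℓ - q)-subset of K \ S are recovered from their union J as J ∩
S and J \ S. -/
lemma choose_mul_choose_le {v : Eucl n} (hv : v ∈ S) (hS : S ⊆ K) {q : ℕ} (hq : q ≤ ℓ) :
    (S.erase v).card.choose q * (K \ S).card.choose (ℓ - q) ≤
      (((K.erase v).powersetCard ℓ).filter fun J => (J ∩ S).card = q).card := by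
  rw [← Finset.card_powersetCard, ← Finset.card_powersetCard, ← Finset.card_product]
  have hdisj : ∀ a ⊆ S.erase v, ∀ b ⊆ K \ S, (a ∪ b) ∩ S = a ∧ (a ∪ b) \ S = b := by
    intro a ha b hb
    have ha' : a ⊆ S := ha.trans (Finset.erase_subset _ _)
    have hb' : ∀ x ∈ b, x ∉ S := fun x hx => (Finset.mem_sdiff.1 (hb hx)).2
    constructor
    · ext x
      simp only [Finset.mem_inter, Finset.mem_union]
      exact ⟨fun ⟨h1, h2⟩ => h1.resolve_right fun h => hb' x h h2, fun h => ⟨Or.inl h, ha' h⟩⟩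
    · ext x
      simp only [Finset.mem_sdiff, Finset.mem_union]
      exact ⟨fun ⟨h1, h2⟩ => h1.resolve_left fun h => h2 (ha' h), fun h => ⟨Or.inr h, hb' x h⟩⟩
  refine Finset.card_le_card_of_injOn (fun x => x.1 ∪ x.2) ?_ ?_
  · rintro ⟨a, b⟩ hab
    simp only [Finset.coe_product, Set.mem_prod, Finset.mem_coe, Finset.mem_powersetCard] at hab
    obtain ⟨⟨ha, ha'⟩, hb, hb'⟩ := hab
    simp only [Finset.mem_coe, Finset.mem_filter, Finset.mem_powersetCard]
    refine ⟨⟨Finset.union_subset (ha.trans (Finset.erase_subset_erase _ hS)) fun x hx => ?_, ?_⟩, ?_⟩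
    · have := Finset.mem_sdiff.1 (hb hx)
      exact Finset.mem_erase.2 ⟨fun h => this.2 (h ▸ hv), this.1⟩
    · rw [Finset.card_union_of_disjoint, ha', hb', Nat.add_sub_cancel' hq]
      rw [Finset.disjoint_left]
      intro x hx hx'
      exact (Finset.mem_sdiff.1 (hb hx')).2 (Finset.mem_of_mem_erase (ha hx))
    · rw [(hdisj a ha b hb).1, ha']
  · rintro ⟨a, b⟩ hab ⟨a', b'⟩ hab' heq
    simp only [Finset.coe_product, Set.mem_prod, Finset.mem_coe, Finset.mem_powersetCard] at hab hab'
    have h1 := hdisj a hab.1.1 b hab.2.1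
    have h2 := hdisj a' hab'.1.1 b' hab'.2.1
    have heq' : a ∪ b = a' ∪ b' := heq
    rw [heq'] at h1
    exact Prod.ext (h1.1.symm.trans h2.1) (h1.2.symm.trans h2.2)

/-- The count for one pair (α, I), with S = supp α ∪ I. Both summands are bounded by numbers of
ℓ-subsets J of the n vertices other than v, and the two kinds of J are disjoint. -/
lemma jDim_add_card_le (hK : K.card = n + 1) {v : Eucl n} (hv : v ∈ S) (hS : S ⊆ K) :
    jDim n ℓ p (sdim S) +
      (((K.erase v).powersetCard ℓ).filter fun J => ℓ + p ≤ sdim (S ∪ J)).card ≤ n.choose ℓ := by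
  have hpos : 0 < S.card := Finset.card_pos.2 ⟨v, hv⟩
  have h1 : (S.erase v).card = sdim S := Finset.card_erase_of_mem hv
  have h2 : (K \ S).card = n - sdim S := by
    rw [Finset.card_sdiff_of_subset hS, hK]
    simp only [sdim]
    omega
  have h3 : jDim n ℓ p (sdim S) ≤
      (((K.erase v).powersetCard ℓ).filter fun J => (J ∩ S).card ∈ jIdx ℓ (sdim S) p).card := by
    have h4 : ((K.erase v).powersetCard ℓ).filter (fun J => (J ∩ S).card ∈ jIdx ℓ (sdim S) p) =
        (jIdx ℓ (sdim S) p).biUnion fun q =>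
          ((K.erase v).powersetCard ℓ).filter fun J => (J ∩ S).card = q := by
      ext J
      simp only [Finset.mem_filter, Finset.mem_biUnion]
      exact ⟨fun h => ⟨_, h.2, h.1, rfl⟩, fun ⟨q, hq, h, h'⟩ => ⟨h, h'.symm ▸ hq⟩⟩
    rw [h4, Finset.card_biUnion]
    · refine Finset.sum_le_sum fun q hq => ?_
      rw [← h2, ← h1]
      exact choose_mul_choose_le hv hS (mem_jIdx.1 hq).1
    · intro q _ q' _ hqq'
      rw [Function.onFun, Finset.disjoint_left]
      intro J hJ hJ'
      exact hqq' ((Finset.mem_filter.1 hJ).2.symm.trans (Finset.mem_filter.1 hJ').2)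
  refine (Nat.add_le_add_right h3 _).trans ?_
  rw [← Finset.card_union_of_disjoint]
  · have : n = (K.erase v).card := by
      rw [Finset.card_erase_of_mem (hS hv), hK, Nat.add_sub_cancel]
    conv_rhs => rw [this, ← Finset.card_powersetCard]
    exact Finset.card_le_card
      (Finset.union_subset (Finset.filter_subset _ _) (Finset.filter_subset _ _))
  -- With q = |J ∩ S| admissible, dim S < q + p, hence dim(S ∪ J) = dim S + ℓ - q < ℓ + p.
  · rw [Finset.disjoint_left]
    intro J hJ hJ'
    obtain ⟨hJ1, hJ2⟩ := Finset.mem_filter.1 hJ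
    have hJ3 := (Finset.mem_filter.1 hJ').2
    have hc := (Finset.mem_powersetCard.1 hJ1).2
    have h5 := Finset.card_union_add_card_inter S J
    rw [Finset.inter_comm] at h5
    have h6 := (mem_jIdx.1 hJ2).2.2
    have h7 := (mem_jIdx.1 hJ2).1
    simp only [sdim] at hJ3 h6
    omega

/-- `pick` depends on the exponent alone and not on the simplex, so the indices of a face are
indices of K. -/
lemma formIdx_mono (h : σ ⊆ K) : formIdx r k σ ⊆ formIdx r k K := by
  rintro ⟨α, I⟩ hx
  obtain ⟨h1, h2⟩ := Finset.mem_sigma.1 hx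
  exact Finset.mem_sigma.2 ⟨expo_mono h h1, Finset.powersetCard_mono (Finset.erase_subset_erase _ h) h2⟩

lemma formIdx₂_mono (h : σ ⊆ K) : formIdx₂ r k ℓ σ ⊆ formIdx₂ r k ℓ K := by
  rintro ⟨α, I, J⟩ hx
  obtain ⟨h1, h2⟩ := Finset.mem_sigma.1 hx
  exact Finset.mem_sigma.2 ⟨expo_mono h h1, Finset.product_subset_product
    (Finset.powersetCard_mono (Finset.erase_subset_erase _ h))
    (Finset.powersetCard_mono (Finset.erase_subset_erase _ h)) h2⟩

/-- Each (α, I) belongs to the bubbles of just one simplex, supp α ∪ I, so the sum over simplices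
becomes a sum over pairs. -/
lemma sum_card_bubbleIdx_le (f : Finset (Eucl n) → ℕ) :
    ∑ σ ∈ K.powerset, (bubbleIdx r k σ).card * f σ ≤
      ∑ x ∈ formIdx r k K, f (x.1.support ∪ x.2) := by
  have hmaps : ∀ x ∈ formIdx r k K, x.1.support ∪ x.2 ∈ K.powerset := by
    rintro ⟨α, I⟩ hx
    obtain ⟨h1, h2⟩ := Finset.mem_sigma.1 hx
    exact Finset.mem_powerset.2 (Finset.union_subset (support_subset h1)
      ((Finset.mem_powersetCard.1 h2).1.trans (Finset.erase_subset _ _)))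
  rw [← Finset.sum_fiberwise_of_maps_to hmaps]
  refine Finset.sum_le_sum fun σ hσ => ?_
  rw [Finset.sum_congr rfl (g := fun _ => f σ) fun x hx => by rw [(Finset.mem_filter.1 hx).2],
    Finset.sum_const, smul_eq_mul]
  exact Nat.mul_le_mul_right _
    (Finset.card_le_card (Finset.filter_subset_filter _ (formIdx_mono (Finset.mem_powerset.1 hσ))))

lemma sum_card_bubbleIdx₂_le (P : Finset (Eucl n) → Prop) [DecidablePred P] :
    ∑ σ ∈ K.powerset.filter P, (bubbleIdx₂ r k ℓ σ).card ≤
      ∑ x ∈ formIdx r k K,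
        (((K.erase (pick x.1)).powersetCard ℓ).filter fun J => P (x.1.support ∪ x.2 ∪ J)).card := by
  have h1 : ∑ σ ∈ K.powerset.filter P, (bubbleIdx₂ r k ℓ σ).card ≤
      ((formIdx₂ r k ℓ K).filter fun x => P (x.1.support ∪ x.2.1 ∪ x.2.2)).card := by
    rw [← Finset.card_biUnion]
    · refine Finset.card_le_card fun x hx => ?_
      obtain ⟨σ, hσ, hx⟩ := Finset.mem_biUnion.1 hx
      obtain ⟨hσ1, hσ2⟩ := Finset.mem_filter.1 hσ
      obtain ⟨hx1, hx2⟩ := Finset.mem_filter.1 hx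
      exact Finset.mem_filter.2 ⟨formIdx₂_mono (Finset.mem_powerset.1 hσ1) hx1, hx2.symm ▸ hσ2⟩
    · intro σ _ τ _ hne
      rw [Function.onFun, Finset.disjoint_left]
      intro x hx hx'
      exact hne ((Finset.mem_filter.1 hx).2.symm.trans (Finset.mem_filter.1 hx').2)
  refine h1.trans (le_of_eq ?_)
  rw [← Finset.card_sigma]
  refine Finset.card_bij (fun x _ => ⟨⟨x.1, x.2.1⟩, x.2.2⟩) ?_ ?_ ?_
  · rintro ⟨α, I, J⟩ hx
    simp only [formIdx₂, formIdx, Finset.mem_filter, Finset.mem_sigma, Finset.mem_product] at hx ⊢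
    tauto
  · rintro ⟨α, I, J⟩ _ ⟨α', I', J'⟩ _ heq
    cases heq
    rfl
  · rintro ⟨⟨α, I⟩, J⟩ hx
    refine ⟨⟨α, I, J⟩, ?_, rfl⟩
    simp only [formIdx₂, formIdx, Finset.mem_filter, Finset.mem_sigma, Finset.mem_product] at hx ⊢
    tauto

/-- The number of degrees of freedom does not exceed the dimension of the shape function space. -/
lemma sum_dof_le (hr : 1 ≤ r) (hK : K.card = n + 1) :
    ∑ σ ∈ K.powerset, (bubbleIdx r k σ).card * jDim n ℓ p (sdim σ) +
      ∑ σ ∈ K.powerset.filter (fun σ => ℓ + p ≤ sdim σ), (bubbleIdx₂ r k ℓ σ).card ≤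
      (expo K r).card * (n.choose k * n.choose ℓ) := by
  refine (Nat.add_le_add (sum_card_bubbleIdx_le fun σ => jDim n ℓ p (sdim σ))
    (sum_card_bubbleIdx₂_le _)).trans ?_
  rw [← Finset.sum_add_distrib]
  refine (Finset.sum_le_card_nsmul _ _ (n.choose ℓ) fun x hx => ?_).trans (le_of_eq ?_)
  · obtain ⟨α, I⟩ := x
    obtain ⟨h1, h2⟩ := Finset.mem_sigma.1 hx
    exact jDim_add_card_le hK (Finset.mem_union_left _ (pick_mem hr h1))
      (Finset.union_subset (support_subset h1)
        ((Finset.mem_powersetCard.1 h2).1.trans (Finset.erase_subset _ _)))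
  · rw [formIdx, Finset.card_sigma, Finset.sum_congr rfl (g := fun _ => n.choose k) fun α hα => by
      rw [Finset.card_powersetCard, Finset.card_erase_of_mem (support_subset hα (pick_mem hr hα)), hK,
        Nat.add_sub_cancel], Finset.sum_const, smul_eq_mul, smul_eq_mul, mul_assoc]

end Counting

/-! ### Vanishing of traces -/

set_option maxSynthPendingDepth 6

section Traces

variable {n r k ℓ p q q' : ℕ} {K σ F : Finset (Eucl n)}

lemma affineIndependent_of_subset (hK : AffineIndependent ℝ ((↑) : K → Eucl n)) (h : σ ⊆ K) :
    AffineIndependent ℝ ((↑) : σ → Eucl n) :=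
  AffineIndependent.mono (s := (σ : Set (Eucl n))) (t := (K : Set (Eucl n))) hK
    (Finset.coe_subset.2 h)

lemma iotaTheta_apply (h : σ ⊆ K) (ω : hull K → AltAlt k ℓ (Eucl n)) (x : hull σ)
    (u : Fin k → tang σ) :
    iotaTheta h q ω x u =
      theta (tang σ) (tang σ)ᗮ ℓ q (ω (Set.inclusion (hull_mono h) x) fun i => u i) := rfl

lemma iotaIota_apply (h : σ ⊆ K) (ω : hull K → AltAlt k ℓ (Eucl n)) (x : hull σ)
    (u : Fin k → tang σ) (z : Fin ℓ → tang σ) :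
    iotaIota h ω x u z = ω (Set.inclusion (hull_mono h) x) (fun i => u i) fun i => z i := rfl

lemma iotaIota_add (h : σ ⊆ K) (ω ω' : hull K → AltAlt k ℓ (Eucl n)) :
    iotaIota h (ω + ω') = iotaIota h ω + iotaIota h ω' :=
  funext fun _ => map_add (pullMap k (tang σ).subtype (pull ℓ ℝ (tang σ).subtype)) _ _

lemma iotaIota_smul (h : σ ⊆ K) (c : ℝ) (ω : hull K → AltAlt k ℓ (Eucl n)) :
    iotaIota h (c • ω) = c • iotaIota h ω :=
  funext fun _ => map_smul (pullMap k (tang σ).subtype (pull ℓ ℝ (tang σ).subtype)) _ _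

lemma iotaTheta_add (h : σ ⊆ K) (ω ω' : hull K → AltAlt k ℓ (Eucl n)) :
    iotaTheta h q (ω + ω') = iotaTheta h q ω + iotaTheta h q ω' :=
  funext fun _ => map_add (pullMap (W' := TanNor q (ℓ - q) σ) k (tang σ).subtype
    (theta (tang σ) (tang σ)ᗮ ℓ q)) _ _

lemma iotaTheta_smul (h : σ ⊆ K) (c : ℝ) (ω : hull K → AltAlt k ℓ (Eucl n)) :
    iotaTheta h q (c • ω) = c • iotaTheta h q ω :=
  funext fun _ => map_smul (pullMap (W' := TanNor q (ℓ - q) σ) k (tang σ).subtype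
    (theta (tang σ) (tang σ)ᗮ ℓ q)) _ _

lemma iotaIota_mem (h : σ ⊆ K) {ω : hull K → AltAlt k ℓ (Eucl n)} (hω : ω ∈ shape r k ℓ K) :
    iotaIota h ω ∈ polyMap (hull σ) r (AltAlt k ℓ (tang σ)) :=
  polyMap_linear_comp (pullMap k (tang σ).subtype (pull ℓ ℝ (tang σ).subtype))
    (polyMap_restrict (hull_mono h) hω)

lemma iotaTheta_mem (h : σ ⊆ K) {ω : hull K → AltAlt k ℓ (Eucl n)} (hω : ω ∈ shape r k ℓ K) :
    iotaTheta h q ω ∈ polyMap (hull σ) r (tang σ [⋀^Fin k]→ₗ[ℝ] TanNor q (ℓ - q) σ) :=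
  polyMap_linear_comp (pullMap (W' := TanNor q (ℓ - q) σ) k (tang σ).subtype
    (theta (tang σ) (tang σ)ᗮ ℓ q)) (polyMap_restrict (hull_mono h) hω)

lemma iotaFace_iotaTheta (hK : AffineIndependent ℝ ((↑) : K → Eucl n)) (hσ : σ ⊆ K) (hF : F ⊆ σ)
    (hne : F.Nonempty) {ω : hull K → AltAlt k ℓ (Eucl n)}
    (h0 : ∀ q' ∈ jIdx ℓ (sdim F) p, iotaTheta (hF.trans hσ) q' ω = 0)
    (hq : q ∈ jIdx ℓ (sdim σ) p) :
    iotaFace k (TanNor q (ℓ - q) σ) hF (iotaTheta hσ q ω) = 0 := by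
  funext x
  refine AlternatingMap.ext fun u => ?_
  rw [iotaFace_apply, iotaTheta_apply]
  refine theta_eq_zero_of_le (tang_mono hF) (p := p) (fun q' hq' => ?_) ?_
  · rw [finrank_tang (affineIndependent_of_subset hK (hF.trans hσ)) hne] at hq'
    have := congrArg (fun f => f u) (congrFun (h0 q' hq') x)
    rw [iotaTheta_apply] at this
    exact this
  · rwa [finrank_tang (affineIndependent_of_subset hK hσ) (hne.mono hF)]

/-- If the degrees of freedom on all subsimplices of `σ` vanish, then so do the traces on `σ`. -/
theorem traces_eq_zero (hK : AffineIndependent ℝ ((↑) : K → Eucl n))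
    {ω : hull K → AltAlt k ℓ (Eucl n)} (hω : ω ∈ shape r k ℓ K) (hσ : σ ⊆ K) (hne : σ.Nonempty)
    (hJ : ∀ (F : Finset (Eucl n)) (hF : F ⊆ K), F ⊆ σ → F.Nonempty → k ≤ sdim F →
      sdim F < ℓ + p → ∀ q ∈ jIdx ℓ (sdim F) p, ∀ b ∈ bubbleTensor r k F (TanNor q (ℓ - q) F),
        pair₃ F (iotaTheta hF q ω) b = 0)
    (hI : ∀ (F : Finset (Eucl n)) (hF : F ⊆ K), F ⊆ σ → F.Nonempty → ℓ + p ≤ sdim F →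
      ∀ b ∈ bubble₂ r k ℓ F, pair₂ F (iotaIota hF ω) b = 0) :
    (∀ q ∈ jIdx ℓ (sdim σ) p, iotaTheta hσ q ω = 0) ∧ iotaIota hσ ω = 0 := by
  induction σ using Finset.strongInduction with
  | H σ ih =>
    have ih' : ∀ (F : Finset (Eucl n)) (hF : F ⊂ σ), F.Nonempty →
        (∀ q ∈ jIdx ℓ (sdim F) p, iotaTheta (hF.subset.trans hσ) q ω = 0) ∧
          iotaIota (hF.subset.trans hσ) ω = 0 := fun F hF hFne =>
      ih F hF (hF.subset.trans hσ) hFne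
        (fun G hG hGF => hJ G hG (hGF.trans hF.subset))
        (fun G hG hGF => hI G hG (hGF.trans hF.subset))
    have hσi := affineIndependent_of_subset hK hσ
    have hfr := finrank_tang hσi hne
    have hθ : ∀ q ∈ jIdx ℓ (sdim σ) p, iotaTheta hσ q ω = 0 := by
      intro q hq
      by_cases hk : k ≤ sdim σ
      · have hmem : iotaTheta hσ q ω ∈ bubbleTensor r k σ (TanNor q (ℓ - q) σ) :=
          mem_bubbleTensor (iotaTheta_mem hσ hω) fun F hF hFne =>
            iotaFace_iotaTheta hK hσ hF.subset hFne (ih' F hF hFne).1 hq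
        have h0 := hJ σ hσ subset_rfl hne hk
          (by have := mem_jIdx.1 hq; omega) q hq _ hmem
        rw [pair₃_eq] at h0
        exact eq_zero_of_pairing_self hσi hne
          (altFun_separating (altFun_separating (altFun_separating idFun_separating)))
          (iotaTheta_mem hσ hω) h0
      -- For dim σ < k there are no nonzero k-forms on σ, so no test is needed.
      · funext x
        have := alternatingMap_subsingleton (V := tang σ) (W := TanNor q (ℓ - q) σ) (k := k)
          (by omega)
        exact Subsingleton.elim _ _
    refine ⟨hθ, ?_⟩
    by_cases hd : ℓ + p ≤ sdim σ
    · have hmem : iotaIota hσ ω ∈ bubble₂ r k ℓ σ :=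
        ⟨iotaIota_mem hσ hω, fun F hF hFne => (ih' F hF hFne).2⟩
      have h0 := hI σ hσ subset_rfl hne hd _ hmem
      rw [pair₂_eq] at h0
      exact eq_zero_of_pairing_self hσi hne
        (altFun_separating (altFun_separating idFun_separating)) (iotaIota_mem hσ hω) h0
    · funext x
      refine AlternatingMap.ext fun u => ?_
      -- For ℓ ≤ dim σ < ℓ + p the value q = ℓ lies in `jIdx`, and this component has all ℓ slots
      -- tangential, so it contains the double trace. Below dimension ℓ there are no nonzero
      -- ℓ-forms.
      by_cases hℓ : ℓ ≤ sdim σ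
      · refine AlternatingMap.ext fun z => ?_
        have h1 := congrArg (fun f => f u)
          (congrFun (hθ ℓ (mem_jIdx.2 ⟨le_rfl, hℓ, by omega⟩)) x)
        rw [iotaIota_apply]
        exact apply_eq_zero_of_theta h1 _ Finset.univ (by simp) (fun i _ => (z i).2) (by simp)
      · have := alternatingMap_subsingleton (V := tang σ) (W := ℝ) (k := ℓ) (by omega)
        exact Subsingleton.elim _ _

lemma tang_eq_top (hK : AffineIndependent ℝ ((↑) : K → Eucl n)) (hc : K.card = n + 1) :
    tang K = ⊤ := by
  refine Submodule.eq_top_of_finrank_eq ?_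
  rw [finrank_tang hK (Finset.card_pos.1 (by omega)), finrank_euclideanSpace_fin, sdim, hc,
    Nat.add_sub_cancel]

lemma eq_zero_of_iotaIota (hK : AffineIndependent ℝ ((↑) : K → Eucl n)) (hc : K.card = n + 1)
    {ω : hull K → AltAlt k ℓ (Eucl n)} (h : iotaIota (subset_refl K) ω = 0) : ω = 0 := by
  have htop : ∀ y : Eucl n, y ∈ tang K := fun y => by
    rw [tang_eq_top hK hc]
    trivial
  funext x
  refine AlternatingMap.ext fun u => AlternatingMap.ext fun z => ?_
  exact congrArg (fun f => f (fun i => (⟨u i, htop _⟩ : tang K)) fun i => (⟨z i, htop _⟩ : tang K))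
    (congrFun h x)

end Traces

/-! ### Bilinearity of the degrees of freedom -/

section Bilinear

variable {n r k ℓ p q q' : ℕ} {K σ : Finset (Eucl n)}

lemma pair₃_add_left (hi : AffineIndependent ℝ ((↑) : σ → Eucl n)) (hσ : σ.Nonempty)
    {η η' b : hull σ → tang σ [⋀^Fin k]→ₗ[ℝ] TanNor q q' σ}
    (hη : η ∈ polyMap (hull σ) r (tang σ [⋀^Fin k]→ₗ[ℝ] TanNor q q' σ))
    (hη' : η' ∈ polyMap (hull σ) r (tang σ [⋀^Fin k]→ₗ[ℝ] TanNor q q' σ))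
    (hb : b ∈ polyMap (hull σ) r (tang σ [⋀^Fin k]→ₗ[ℝ] TanNor q q' σ)) :
    pair₃ σ (η + η') b = pair₃ σ η b + pair₃ σ η' b := by
  simp only [pair₃_eq]
  exact pairing_add_left hi hσ hη hη' hb

lemma pair₃_smul_left (c : ℝ) (η b : hull σ → tang σ [⋀^Fin k]→ₗ[ℝ] TanNor q q' σ) :
    pair₃ σ (c • η) b = c * pair₃ σ η b := by
  simp only [pair₃_eq]
  exact pairing_smul_left c η b

lemma pair₃_comm (η b : hull σ → tang σ [⋀^Fin k]→ₗ[ℝ] TanNor q q' σ) :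
    pair₃ σ η b = pair₃ σ b η := by
  simp only [pair₃_eq]
  exact pairing_comm η b

lemma pair₃_zero_right (η : hull σ → tang σ [⋀^Fin k]→ₗ[ℝ] TanNor q q' σ) : pair₃ σ η 0 = 0 := by
  have := pair₃_smul_left 0 (0 : hull σ → tang σ [⋀^Fin k]→ₗ[ℝ] TanNor q q' σ) η
  rw [zero_smul, zero_mul] at this
  rw [pair₃_comm, this]

lemma pair₂_add_left (hi : AffineIndependent ℝ ((↑) : σ → Eucl n)) (hσ : σ.Nonempty)
    {η η' b : hull σ → AltAlt k ℓ (tang σ)}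
    (hη : η ∈ polyMap (hull σ) r (AltAlt k ℓ (tang σ)))
    (hη' : η' ∈ polyMap (hull σ) r (AltAlt k ℓ (tang σ)))
    (hb : b ∈ polyMap (hull σ) r (AltAlt k ℓ (tang σ))) :
    pair₂ σ (η + η') b = pair₂ σ η b + pair₂ σ η' b := by
  simp only [pair₂_eq]
  exact pairing_add_left hi hσ hη hη' hb

lemma pair₂_smul_left (c : ℝ) (η b : hull σ → AltAlt k ℓ (tang σ)) :
    pair₂ σ (c • η) b = c * pair₂ σ η b := by
  simp only [pair₂_eq]
  exact pairing_smul_left c η b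

lemma pair₂_comm (η b : hull σ → AltAlt k ℓ (tang σ)) : pair₂ σ η b = pair₂ σ b η := by
  simp only [pair₂_eq]
  exact pairing_comm η b

/-- The degrees of freedom `⟨ι_σ^* ι_σ^* ω, b⟩_σ` as a bilinear map. -/
def dofI (hi : AffineIndependent ℝ ((↑) : σ → Eucl n)) (hσ : σ.Nonempty) (h : σ ⊆ K)
    (r k ℓ : ℕ) : shape r k ℓ K →ₗ[ℝ] bubble₂ r k ℓ σ →ₗ[ℝ] ℝ :=
  LinearMap.mk₂ ℝ (fun ω b => pair₂ σ (iotaIota h ω.1) b.1)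
    (fun ω ω' b => by
      rw [Submodule.coe_add, iotaIota_add]
      exact pair₂_add_left hi hσ (iotaIota_mem h ω.2) (iotaIota_mem h ω'.2) b.2.1)
    (fun c ω b => by
      rw [Submodule.coe_smul, iotaIota_smul, pair₂_smul_left, smul_eq_mul])
    (fun ω b b' => by
      simp only [pair₂_comm (iotaIota h ω.1)]
      exact pair₂_add_left hi hσ b.2.1 b'.2.1 (iotaIota_mem h ω.2))
    (fun c ω b => by
      simp only [pair₂_comm (iotaIota h ω.1)]
      exact pair₂_smul_left c b.1 _)

/-- The degrees of freedom `⟨ι_σ^* j_{σ,[p]}^* ω, b⟩_σ` as a bilinear map. -/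
def dofJ (hi : AffineIndependent ℝ ((↑) : σ → Eucl n)) (hσ : σ.Nonempty) (h : σ ⊆ K)
    (r k ℓ p : ℕ) : shape r k ℓ K →ₗ[ℝ] testJp r k ℓ p σ →ₗ[ℝ] ℝ :=
  LinearMap.mk₂ ℝ (fun ω b => pairJp σ (iotaJp p h ω.1) b)
    (fun ω ω' b => by
      simp only [pairJp, ← Finset.sum_add_distrib]
      refine Finset.sum_congr rfl fun q _ => ?_
      rw [iotaJp, Submodule.coe_add, iotaTheta_add]
      exact pair₃_add_left hi hσ (iotaTheta_mem h ω.2) (iotaTheta_mem h ω'.2)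
        (bubbleTensor_le_polyMap (b q).2))
    (fun c ω b => by
      simp only [pairJp, smul_eq_mul, Finset.mul_sum]
      refine Finset.sum_congr rfl fun q _ => ?_
      rw [iotaJp, Submodule.coe_smul, iotaTheta_smul, pair₃_smul_left]
      rfl)
    (fun ω b b' => by
      simp only [pairJp, ← Finset.sum_add_distrib]
      refine Finset.sum_congr rfl fun q _ => ?_
      simp only [pair₃_comm (iotaJp p h ω.1 q)]
      exact pair₃_add_left hi hσ (bubbleTensor_le_polyMap (b q).2)
        (bubbleTensor_le_polyMap (b' q).2) (iotaTheta_mem h ω.2))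
    (fun c ω b => by
      simp only [pairJp, smul_eq_mul, Finset.mul_sum]
      refine Finset.sum_congr rfl fun q _ => ?_
      simp only [pair₃_comm (iotaJp p h ω.1 q)]
      exact pair₃_smul_left c (b q).1 _)

/-- Testing with a single summand separates the components of the direct sum. -/
lemma pairJp_single
    (η : ∀ q : jIdx ℓ (sdim σ) p, hull σ → tang σ [⋀^Fin k]→ₗ[ℝ] TanNor (q : ℕ) (ℓ - q) σ)
    (q : jIdx ℓ (sdim σ) p) (b : bubbleTensor r k σ (TanNor (q : ℕ) (ℓ - q) σ)) :
    pairJp (r := r) σ η (Pi.single q b) = pair₃ σ (η q) b.1 := by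
  rw [pairJp, Finset.sum_eq_single q]
  · rw [Pi.single_eq_same]
  · intro q' _ hq'
    rw [Pi.single_eq_of_ne hq']
    exact pair₃_zero_right _
  · simp

end Bilinear

/-! ### Unisolvence -/

/-- A separating family of pairings with test spaces whose dimensions add up to at most the
dimension of `V` identifies `V` with the product of the duals of the test spaces. -/
lemma existsUnique_of_finrank_le {V ι κ : Type*} [AddCommGroup V] [Module ℝ V] [Module.Finite ℝ V]
    [Fintype ι] [Fintype κ] (X : ι → Type*) [∀ i, AddCommGroup (X i)] [∀ i, Module ℝ (X i)]
    (hX : ∀ i, Module.Finite ℝ (X i)) (Y : κ → Type*) [∀ j, AddCommGroup (Y j)]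
    [∀ j, Module ℝ (Y j)] (hY : ∀ j, Module.Finite ℝ (Y j))
    (f : ∀ i, V →ₗ[ℝ] X i →ₗ[ℝ] ℝ) (g : ∀ j, V →ₗ[ℝ] Y j →ₗ[ℝ] ℝ)
    (hinj : ∀ v, (∀ i x, f i v x = 0) → (∀ j y, g j v y = 0) → v = 0)
    (hdim : ∑ i, Module.finrank ℝ (X i) + ∑ j, Module.finrank ℝ (Y j) ≤ Module.finrank ℝ V)
    (L : ∀ i, X i →ₗ[ℝ] ℝ) (M : ∀ j, Y j →ₗ[ℝ] ℝ) :
    ∃! v, (∀ i x, f i v x = L i x) ∧ ∀ j y, g j v y = M j y := by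
  let Φ : V →ₗ[ℝ] (∀ i, Module.Dual ℝ (X i)) × (∀ j, Module.Dual ℝ (Y j)) :=
    (LinearMap.pi f).prod (LinearMap.pi g)
  have hΦ : Function.Injective Φ := by
    rw [← LinearMap.ker_eq_bot, LinearMap.ker_eq_bot']
    intro v hv
    refine hinj v (fun i x => ?_) fun j y => ?_
    · exact congrArg (fun F => F x) (congrFun (congrArg Prod.fst hv) i)
    · exact congrArg (fun F => F y) (congrFun (congrArg Prod.snd hv) j)
  have hfr : Module.finrank ℝ ((∀ i, Module.Dual ℝ (X i)) × (∀ j, Module.Dual ℝ (Y j))) =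
      ∑ i, Module.finrank ℝ (X i) + ∑ j, Module.finrank ℝ (Y j) := by
    rw [Module.finrank_prod, Module.finrank_pi_fintype, Module.finrank_pi_fintype]
    simp only [Subspace.dual_finrank_eq]
  have hle := LinearMap.finrank_le_finrank_of_injective hΦ
  have hsurj : Function.Surjective Φ :=
    (LinearMap.injective_iff_surjective_of_finrank_eq_finrank
      (le_antisymm hle (hfr ▸ hdim))).1 hΦ
  obtain ⟨v, hv⟩ := hsurj (L, M)
  refine ⟨v, ⟨fun i x => ?_, fun j y => ?_⟩, fun v' hv' => hΦ ?_⟩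
  · exact congrArg (fun F => F x) (congrFun (congrArg Prod.fst hv) i)
  · exact congrArg (fun F => F y) (congrFun (congrArg Prod.snd hv) j)
  · rw [hv]
    exact Prod.ext (funext fun i => LinearMap.ext (hv'.1 i))
      (funext fun j => LinearMap.ext (hv'.2 j))

lemma sum_comp_le_sum {ι β : Type*} [Fintype ι] {φ : ι → β} (hφ : Function.Injective φ)
    {s : Finset β} (hs : ∀ i, φ i ∈ s) (f : β → ℕ) : ∑ i, f (φ i) ≤ ∑ x ∈ s, f x := by
  rw [← Finset.sum_image (s := Finset.univ) (g := φ) (f := f) hφ.injOn]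
  exact Finset.sum_le_sum_of_subset fun x hx => by
    obtain ⟨i, -, rfl⟩ := Finset.mem_image.1 hx
    exact hs i

section Unisolvence

variable {n r k ℓ p : ℕ} {K σ : Finset (Eucl n)} {lam : Eucl n → Eucl n →ᵃ[ℝ] ℝ}

lemma finrank_tanNor (hi : AffineIndependent ℝ ((↑) : σ → Eucl n)) (hne : σ.Nonempty) (q q' : ℕ) :
    Module.finrank ℝ (TanNor q q' σ) = (sdim σ).choose q * (n - sdim σ).choose q' := by
  have h1 := (tang σ).finrank_add_finrank_orthogonal
  rw [finrank_tang hi hne, finrank_euclideanSpace_fin] at h1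
  have h2 : Module.finrank ℝ (tang σ)ᗮ = n - sdim σ := by omega
  rw [finrank_alternatingMap, finrank_alternatingMap, finrank_tang hi hne, h2, Module.finrank_self,
    mul_one]

lemma finrank_testJp_le (hr : 1 ≤ r) (h : IsBary σ lam)
    (hi : AffineIndependent ℝ ((↑) : σ → Eucl n)) (hne : σ.Nonempty) :
    Module.Finite ℝ (testJp r k ℓ p σ) ∧
      Module.finrank ℝ (testJp r k ℓ p σ) ≤ (bubbleIdx r k σ).card * jDim n ℓ p (sdim σ) := by
  have hb := fun q : jIdx ℓ (sdim σ) p =>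
    finrank_bubbleTensor_le (k := k) (W := TanNor (q : ℕ) (ℓ - q) σ) hr h hi
  have hfin : ∀ q : jIdx ℓ (sdim σ) p,
      Module.Finite ℝ (bubbleTensor r k σ (TanNor (q : ℕ) (ℓ - q) σ)) := fun q => (hb q).1
  refine ⟨inferInstance, ?_⟩
  rw [Module.finrank_pi_fintype, jDim, Finset.mul_sum,
    ← Finset.sum_coe_sort (jIdx ℓ (sdim σ) p)]
  refine Finset.sum_le_sum fun q _ => ((hb q).2.trans (le_of_eq ?_))
  rw [finrank_tanNor hi hne]

lemma testJp_eq_zero (hi : AffineIndependent ℝ ((↑) : σ → Eucl n)) (hne : σ.Nonempty)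
    (h : ¬ (k ≤ sdim σ ∧ sdim σ < ℓ + p)) (b : testJp r k ℓ p σ) : b = 0 := by
  funext q
  have hq := mem_jIdx.1 q.2
  have := alternatingMap_subsingleton (V := tang σ) (k := k)
    (W := TanNor (q : ℕ) (ℓ - q) σ) (by rw [finrank_tang hi hne]; omega)
  have h0 : (b q).1 = 0 := funext fun x => Subsingleton.elim _ _
  exact Subtype.ext h0

/-- A shape function is zero if all its degrees of freedom vanish. -/
lemma shape_eq_zero_of_dof (hK : AffineIndependent ℝ ((↑) : K → Eucl n)) (hc : K.card = n + 1)
    {ω : shape r k ℓ K}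
    (h1 : ∀ (σ : Face K) (b : testJp r k ℓ p σ.1), pairJp σ.1 (iotaJp p σ.2.1 ω.1) b = 0)
    (h2 : ∀ σ : Face K, ℓ + p ≤ sdim σ.1 → ∀ b : bubble₂ r k ℓ σ.1,
      pair₂ σ.1 (iotaIota σ.2.1 ω.1) b.1 = 0) : ω = 0 := by
  have := (traces_eq_zero (p := p) hK ω.2 (subset_refl K) (Finset.card_pos.1 (by omega))
    (fun F hF _ hne _ _ q hq b hb => by
      have := h1 ⟨F, hF, hne⟩ (Pi.single ⟨q, hq⟩ ⟨b, hb⟩)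
      rwa [pairJp_single] at this)
    (fun F hF _ hne hd b hb => h2 ⟨F, hF, hne⟩ hd ⟨b, hb⟩)).2
  exact Subtype.ext (eq_zero_of_iotaIota hK hc this)

theorem unisolventIJp (hr : 1 ≤ r) (p : ℕ) (hK : AffineIndependent ℝ ((↑) : K → Eucl n))
    (hc : K.card = n + 1) : UnisolventIJp r k ℓ p K := by
  intro L M
  obtain ⟨lam, hlam⟩ := exists_isBary hK hc
  have hKne : K.Nonempty := Finset.card_pos.1 (by omega)
  have hi : ∀ σ : Face K, AffineIndependent ℝ ((↑) : σ.1 → Eucl n) := fun σ =>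
    affineIndependent_of_subset hK σ.2.1
  have : Finite (Face K) := Finite.of_injective
    (fun σ : Face K => (⟨σ.1, Finset.mem_powerset.2 σ.2.1⟩ : K.powerset))
    fun σ τ hστ => Subtype.ext (congrArg (fun x : K.powerset => x.1) hστ)
  have : Fintype (Face K) := Fintype.ofFinite _
  have hJ := fun σ : Face K =>
    finrank_testJp_le (k := k) (ℓ := ℓ) (p := p) hr (hlam.mono σ.2.1) (hi σ) σ.2.2
  have hI := fun σ : {σ : Face K // ℓ + p ≤ sdim σ.1} =>
    finrank_bubble₂_le (k := k) (ℓ := ℓ) hr (hlam.mono σ.1.2.1) (hi σ.1)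
  obtain ⟨hSfin, hSdim⟩ := finrank_polyMap (r := r) (W := AltAlt k ℓ (Eucl n)) hlam hKne
  rw [finrank_alternatingMap, finrank_alternatingMap, finrank_euclideanSpace_fin,
    Module.finrank_self, mul_one] at hSdim
  have hdim : ∑ σ : Face K, Module.finrank ℝ (testJp r k ℓ p σ.1) +
      ∑ σ : {σ : Face K // ℓ + p ≤ sdim σ.1}, Module.finrank ℝ (bubble₂ r k ℓ σ.1.1) ≤
      Module.finrank ℝ (shape r k ℓ K) := by
    rw [hSdim]
    refine le_trans (Nat.add_le_add ?_ ?_) (sum_dof_le (k := k) (ℓ := ℓ) (p := p) hr hc)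
    · exact (Finset.sum_le_sum fun σ _ => (hJ σ).2).trans
        (sum_comp_le_sum (φ := fun σ : Face K => σ.1) Subtype.val_injective
          (fun σ => Finset.mem_powerset.2 σ.2.1)
          fun σ => (bubbleIdx r k σ).card * jDim n ℓ p (sdim σ))
    · exact (Finset.sum_le_sum fun σ _ => (hI σ).2).trans
        (sum_comp_le_sum (φ := fun σ : {σ : Face K // ℓ + p ≤ sdim σ.1} => σ.1.1)
          (Subtype.val_injective.comp Subtype.val_injective)
          (fun σ => Finset.mem_filter.2 ⟨Finset.mem_powerset.2 σ.1.2.1, σ.2⟩)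
          fun σ => (bubbleIdx₂ r k ℓ σ).card)
  obtain ⟨ω, ⟨hω1, hω2⟩, huniq⟩ := existsUnique_of_finrank_le
    (fun σ : Face K => testJp r k ℓ p σ.1) (fun σ => (hJ σ).1)
    (fun σ : {σ : Face K // ℓ + p ≤ sdim σ.1} => bubble₂ r k ℓ σ.1.1) (fun σ => (hI σ).1)
    (fun σ => dofJ (hi σ) σ.2.2 σ.2.1 r k ℓ p)
    (fun σ => dofI (hi σ.1) σ.1.2.2 σ.1.2.1 r k ℓ)
    (fun ω h1 h2 => shape_eq_zero_of_dof hK hc h1 fun σ hσ b => h2 ⟨σ, hσ⟩ b)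
    hdim
    -- Outside the prescribed dimensions the test space is zero by `testJp_eq_zero`, so the value 0
    -- imposes nothing and the family can be indexed by all faces.
    (fun σ => if h : k ≤ sdim σ.1 ∧ sdim σ.1 < ℓ + p then L σ h.1 h.2 else 0)
    (fun σ => M σ.1 σ.2)
  refine ⟨ω, ⟨fun σ h1 h2 b => ?_, fun σ h b => hω2 ⟨σ, h⟩ b⟩, fun ω' hω' => huniq ω'
    ⟨fun σ b => ?_, fun σ b => hω'.2 σ.1 σ.2 b⟩⟩
  · have := hω1 σ b
    rw [dif_pos ⟨h1, h2⟩] at this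
    exact this
  · by_cases h : k ≤ sdim σ.1 ∧ sdim σ.1 < ℓ + p
    · rw [dif_pos h]
      exact hω'.1 σ h.1 h.2 b
    · rw [dif_neg h]
      have hb : b = 0 := testJp_eq_zero (hi σ) σ.2.2 h b
      rw [hb]
      exact LinearMap.map_zero (dofJ (hi σ) σ.2.2 σ.2.1 r k ℓ p ω')

lemma altAlt_subsingleton (hi : AffineIndependent ℝ ((↑) : σ → Eucl n)) (hne : σ.Nonempty)
    (h : sdim σ < ℓ) : Subsingleton (AltAlt k ℓ (tang σ)) := by
  have := alternatingMap_subsingleton (V := tang σ) (W := ℝ) (k := ℓ)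
    (by rwa [finrank_tang hi hne])
  exact ⟨fun f g => AlternatingMap.ext fun u => Subsingleton.elim _ _⟩

lemma isEmpty_jIdx_zero (ℓ m : ℕ) : IsEmpty (jIdx ℓ m 0) :=
  ⟨fun q => by have := mem_jIdx.1 q.2; omega⟩

/-- The case p = 0: the generalized-trace test spaces are empty products, and bubbles of the double
trace are zero in dimensions below ℓ. -/
theorem unisolventII (hr : 1 ≤ r) (hK : AffineIndependent ℝ ((↑) : K → Eucl n))
    (hc : K.card = n + 1) : UnisolventII r k ℓ K := by
  intro L
  obtain ⟨ω, hω, huniq⟩ := unisolventIJp (k := k) (ℓ := ℓ) hr 0 hK hc (fun _ _ _ => 0)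
    fun σ _ => L σ
  refine ⟨ω, fun σ b => ?_, fun ω' hω' => huniq ω' ⟨fun σ _ _ b => ?_, fun σ _ b => hω' σ b⟩⟩
  · by_cases h : ℓ ≤ sdim σ.1
    · exact hω.2 σ h b
    · have := altAlt_subsingleton (k := k) (affineIndependent_of_subset hK σ.2.1) σ.2.2
        (not_le.1 h)
      have hb : b = 0 := Subtype.ext (funext fun x => Subsingleton.elim _ _)
      rw [hb, map_zero]
      exact map_zero (dofI (affineIndependent_of_subset hK σ.2.1) σ.2.2 σ.2.1 r k ℓ ω)
  · have := isEmpty_jIdx_zero ℓ (sdim σ.1)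
    rw [pairJp, Finset.univ_eq_empty, Finset.sum_empty, LinearMap.zero_apply]

lemma mem_jIdx_one {m : ℕ} (h : m ≤ ℓ) : m ∈ jIdx ℓ m 1 := mem_jIdx.2 ⟨h, le_rfl, by omega⟩

lemma pairJp_one (h : sdim σ ≤ ℓ)
    (η : ∀ q : jIdx ℓ (sdim σ) 1, hull σ → tang σ [⋀^Fin k]→ₗ[ℝ] TanNor (q : ℕ) (ℓ - q) σ)
    (b : testJp r k ℓ 1 σ) :
    pairJp σ η b = pair₃ σ (η ⟨sdim σ, mem_jIdx_one h⟩) (b ⟨sdim σ, mem_jIdx_one h⟩).1 := by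
  rw [pairJp, Finset.sum_eq_single ⟨sdim σ, mem_jIdx_one h⟩]
  · intro q _ hq
    refine absurd (Subtype.ext ?_) hq
    have := mem_jIdx.1 q.2
    change (q : ℕ) = sdim σ
    omega
  · simp

/-- The case p = 1: for dim σ ≤ ℓ the only admissible q is dim σ. -/
theorem unisolventIJ (hr : 1 ≤ r) (hK : AffineIndependent ℝ ((↑) : K → Eucl n))
    (hc : K.card = n + 1) : UnisolventIJ r k ℓ K := by
  intro L M
  obtain ⟨ω, hω, huniq⟩ := unisolventIJp (k := k) (ℓ := ℓ) hr 1 hK hc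
    (fun σ h1 h2 => (L σ h1 (Nat.lt_succ_iff.1 h2)).comp
      (LinearMap.proj (R := ℝ)
        (φ := fun q : jIdx ℓ (sdim σ.1) 1 => bubbleTensor r k σ.1 (TanNor (q : ℕ) (ℓ - q) σ.1))
        ⟨sdim σ.1, mem_jIdx_one (Nat.lt_succ_iff.1 h2)⟩))
    fun σ h => M σ h
  refine ⟨ω, ⟨fun σ h1 h2 b => ?_, fun σ h b => hω.2 σ h b⟩,
    fun ω' hω' => huniq ω' ⟨fun σ h1 h2 b => ?_, fun σ h b => hω'.2 σ h b⟩⟩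
  · have := hω.1 σ h1 (Nat.lt_succ_iff.2 h2) (Pi.single ⟨sdim σ.1, mem_jIdx_one h2⟩ b)
    rw [pairJp_single, LinearMap.comp_apply, LinearMap.proj_apply, Pi.single_eq_same] at this
    exact this
  · rw [pairJp_one (Nat.lt_succ_iff.1 h2)]
    exact hω'.1 σ h1 (Nat.lt_succ_iff.1 h2) _

end Unisolvence

/-! ### Conformity -/

section Conformity

variable {n r k ℓ p : ℕ} {T : Geometry.SimplicialComplex ℝ (Eucl n)}

/-- Vanishing of the traces on σ uses only the degrees of freedom on subsimplices of σ, all of which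
are shared by the two cells. It is applied on one cell to the difference of the two forms. -/
theorem traces_eq_of_mem_spaceIJp {ω : Piecewise k ℓ T} (hω : ω ∈ spaceIJp r k ℓ p T)
    (K K' : Cell T) (σ : Finset (Eucl n)) (h : σ ⊆ K.1) (h' : σ ⊆ K'.1) (hne : σ.Nonempty) :
    (∀ q ∈ jIdx ℓ (sdim σ) p, iotaTheta h q (ω K) = iotaTheta h' q (ω K')) ∧
      iotaIota h (ω K) = iotaIota h' (ω K') := by
  have hK := T.indep K.2.1
  -- `g` is a polynomial form on K agreeing with ω_{K'} on the intersection of the cells; this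
  -- contains every common face F, and the traces on F see only values there.
  obtain ⟨g, hg, hgω⟩ := exists_polyMap_eq_on_inter (hull K.1) (hω.1 K')
  have hd : ω K - g ∈ shape r k ℓ K.1 := sub_mem (hω.1 K) hg
  have hsum : ω K = (ω K - g) + g := (sub_add_cancel _ _).symm
  have hθ : ∀ (F : Finset (Eucl n)) (hF : F ⊆ K.1) (hF' : F ⊆ K'.1) (q : ℕ),
      iotaTheta hF q (ω K) = iotaTheta hF q (ω K - g) + iotaTheta hF' q (ω K') := by
    intro F hF hF' q
    have : iotaTheta hF' q (ω K') = iotaTheta hF q g := by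
      funext x
      refine AlternatingMap.ext fun u => ?_
      rw [iotaTheta_apply, iotaTheta_apply]
      exact congrArg (fun f => theta (tang F) (tang F)ᗮ ℓ q (f fun i => (u i : Eucl n)))
        (hgω x (hull_mono hF' x.2) (hull_mono hF x.2)).symm
    rw [this, ← iotaTheta_add, ← hsum]
  have hι : ∀ (F : Finset (Eucl n)) (hF : F ⊆ K.1) (hF' : F ⊆ K'.1),
      iotaIota hF (ω K) = iotaIota hF (ω K - g) + iotaIota hF' (ω K') := by
    intro F hF hF'
    have : iotaIota hF' (ω K') = iotaIota hF g := by
      funext x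
      refine AlternatingMap.ext fun u => AlternatingMap.ext fun z => ?_
      rw [iotaIota_apply, iotaIota_apply]
      exact congrArg (fun f => f (fun i => (u i : Eucl n)) fun i => (z i : Eucl n))
        (hgω x (hull_mono hF' x.2) (hull_mono hF x.2)).symm
    rw [this, ← iotaIota_add, ← hsum]
  obtain ⟨h1, h2⟩ := traces_eq_zero (p := p) hK hd h hne
    (fun F hF hFσ hFne hk hFp q hq b hb => by
      have hF' := hFσ.trans h'
      have h1 := (hω.2 K K' F hF hF' hFne).1 hk hFp (Pi.single ⟨q, hq⟩ ⟨b, hb⟩)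
      rw [pairJp_single, pairJp_single, iotaJp, iotaJp, hθ F hF hF' q] at h1
      have h2 := pair₃_add_left (affineIndependent_of_subset hK hF) hFne
        (iotaTheta_mem (q := q) hF hd) (iotaTheta_mem (q := q) hF' (hω.1 K'))
        (bubbleTensor_le_polyMap hb)
      exact left_eq_add.1 (h1.symm.trans (h2.trans (add_comm _ _))))
    (fun F hF hFσ hFne hFp b hb => by
      have hF' := hFσ.trans h'
      have h1 := (hω.2 K K' F hF hF' hFne).2 hFp b hb
      rw [hι F hF hF', pair₂_add_left (affineIndependent_of_subset hK hF) hFne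
        (iotaIota_mem hF hd) (iotaIota_mem hF' (hω.1 K')) hb.1] at h1
      exact add_eq_right.1 h1)
  refine ⟨fun q hq => ?_, ?_⟩
  · rw [hθ σ h h' q, h1 q hq, zero_add]
  · rw [hι σ h h', h2, zero_add]

theorem conformingII {ω : Piecewise k ℓ T} (hω : ω ∈ spaceII r k ℓ T) : ConformingII k ℓ T ω := by
  intro K K' σ h h' hne
  refine (traces_eq_of_mem_spaceIJp (r := r) (p := 0) ⟨hω.1, fun K K' σ h h' hne =>
    ⟨fun _ _ b => ?_, fun _ => hω.2 K K' σ h h' hne⟩⟩ K K' σ h h' hne).2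
  have := isEmpty_jIdx_zero ℓ (sdim σ)
  rw [pairJp, pairJp, Finset.univ_eq_empty, Finset.sum_empty, Finset.sum_empty]

theorem conformingIJ {ω : Piecewise k ℓ T} (hω : ω ∈ spaceIJ r k ℓ T) : ConformingIJ k ℓ T ω := by
  have hω' : ω ∈ spaceIJp r k ℓ 1 T := by
    refine ⟨hω.1, fun K K' σ h h' hne => ⟨fun h1 h2 b => ?_, fun h1 => ?_⟩⟩
    · have h3 := Nat.lt_succ_iff.1 h2
      rw [pairJp_one h3, pairJp_one h3]
      exact (hω.2 K K' σ h h' hne).1 h1 h3 _ (b ⟨sdim σ, mem_jIdx_one h3⟩).2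
    · exact (hω.2 K K' σ h h' hne).2 h1
  intro K K' σ h h' hne
  obtain ⟨h1, h2⟩ := traces_eq_of_mem_spaceIJp hω' K K' σ h h' hne
  exact ⟨fun hd => h1 _ (mem_jIdx_one hd), fun _ => h2⟩

theorem conformingIJp {ω : Piecewise k ℓ T} (hω : ω ∈ spaceIJp r k ℓ p T) :
    ConformingIJp k ℓ p T ω := by
  intro K K' σ h h' hne
  obtain ⟨h1, h2⟩ := traces_eq_of_mem_spaceIJp hω K K' σ h h' hne
  exact ⟨fun _ => funext fun q => h1 q q.2, fun _ => h2⟩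

end Conformity

end

end FormValuedForm

theorem mainTheorem11 (n r k ℓ p : ℕ) (hr : 1 ≤ r) (hp : 1 ≤ p) :
    (∀ K : Finset (EuclideanSpace ℝ (Fin n)),
      AffineIndependent ℝ ((↑) : K → EuclideanSpace ℝ (Fin n)) → K.card = n + 1 →
        FormValuedForm.UnisolventII r k ℓ K ∧
        FormValuedForm.UnisolventIJ r k ℓ K ∧
        FormValuedForm.UnisolventIJp r k ℓ p K) ∧
    (∀ T : Geometry.SimplicialComplex ℝ (EuclideanSpace ℝ (Fin n)),
      (∀ ω ∈ FormValuedForm.spaceII r k ℓ T, FormValuedForm.ConformingII k ℓ T ω) ∧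
      (∀ ω ∈ FormValuedForm.spaceIJ r k ℓ T, FormValuedForm.ConformingIJ k ℓ T ω) ∧
      (∀ ω ∈ FormValuedForm.spaceIJp r k ℓ p T, FormValuedForm.ConformingIJp k ℓ p T ω)) := by
  refine ⟨fun K hK hc => ⟨FormValuedForm.unisolventII hr hK hc,
    FormValuedForm.unisolventIJ hr hK hc, FormValuedForm.unisolventIJp hr p hK hc⟩,
    fun T => ⟨fun ω hω => FormValuedForm.conformingII hω,
      fun ω hω => FormValuedForm.conformingIJ hω, fun ω hω => FormValuedForm.conformingIJp hω⟩⟩
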